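/- **Theorem 3 (Gradient and Hessian in expectation).** Let $\phi(t)=t$ (linear networks, $p=1$) or $\phi(t)=\max\{t,0\}$ (ReLU networks, $p=\tfrac12$). For inputs $x_1,\dots,x_n\in\mathbb R^{d_{in}}$, targets $y_1,\dots,y_n\in\mathbb R^{d_{out}}$, matrices $A\in\mathbb R^{d\times d_{in}}$, $B\in\mathbb R^{d_{out}\times d}$ and weights $W=(W^1,\dots,W^L)$, $W^\ell\in\mathbb R^{d\times d}$, let $$\mathcal L(W)=\frac1{2n}\sum_{i=1}^n\big\|y_i-BD_i^LW^LD_i^{L-1}W^{L-1}\cdots W^1D_i^0Ax_i\big\|_2^2 ,$$ where $D_i^\ell$ is the diagonal matrix of activation gates of layer $\ell$ for the input $x_i$ ($D_i^\ell=I$ for linear networks; for ReLU networks its diagonal entries are $1$ where the preactivation is positive and $0$ elsewhere), so that $\mathcal L$ is the squared loss of the multilayer perceptron with hidden activation $\phi$. Derivatives of $\mathcal L$ at $W$ are taken, as in backpropagation, with the gates held at their values at $W$. Let all entries of all $W^\ell$ be i.i.d. with a law $\mathcal P$ on $\mathbb R$ that is symmetric around $0$ and has variance $\sigma^2<\infty$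 and finite fourth moment. Put $\lambda=pd\sigma^2$, and put $\delta=1$ for linear networks and $\delta=d$ for ReLU networks. Let $R\in\mathbb R$. 1. (Fixed $A$, $B$.) There is a constant $C$ depending only on $R$ such that, whenever $\|B\|_F\le R$ and $\|Ax_i\|_2\le R$, $\|y_i\|_2\le R$ for all $i$, the following expectations are finite and, for all $k\neq\ell$, $$\mathbb E\Big\|\frac{\partial\mathcal L}{\partial W^k}\Big\|_F\le C\sqrt\delta\,\big(\lambda^{\frac{L-1}2}+\lambda^{\frac{2L-1}2}\big),\quad \mathbb E\Big\|\frac{\partial^2\mathcal L}{\partial W^k\partial W^k}\Big\|_F\le C\,\delta\,\lambda^{L-1},\quad \mathbb E\Big\|\frac{\partial^2\mathcal L}{\partial W^k\partial W^\ell}\Big\|_F\le C\sqrt{d\delta}\,\big(\lambda^{\frac{L-2}2}+\lambda^{L-1}\big).$$ In particular the diagonal blocks are at most $C\frac{\delta}{\lambda}\,\lambda^{L}$ if $\lambda>0$, and in the vanishing-stable regime $0<\lambda\le1$ the gradient is at most $C\sqrt{\delta/\lambda}\;\lambda^{L/2}$ and the off-diagonal blocks are at most $C\frac{\sqrt{d\delta}}{\lambda}\,\lambda^{L/2}$,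 in expectation. 2. (Random $A$, $B$.) For every $d_{out}$ there is a constant $C$ depending only on $R$ and $d_{out}$ such that, if the entries of $A$, $B$ and of all $W^\ell$ together are i.i.d. with law $\mathcal P$ and $\|x_i\|_2\le R$, $\|y_i\|_2\le R$ for all $i$, the expectations are finite and, for all $k\ne\ell$, $$\mathbb E\Big\|\frac{\partial\mathcal L}{\partial W^k}\Big\|_F\le C\big(\lambda^{\frac{L+1}2}+\lambda^{\frac{2L+3}2}\big),\quad \mathbb E\Big\|\frac{\partial^2\mathcal L}{\partial W^k\partial W^k}\Big\|_F\le C\lambda^{L+1},\quad \mathbb E\Big\|\frac{\partial^2\mathcal L}{\partial W^k\partial W^\ell}\Big\|_F\le C\big(\sqrt d\,\lambda^{\frac L2}+\lambda^{L+1}\big).$$ In particular, if $\lambda\le1$, these expectations are at most $C\lambda^{L/2}$, $C\lambda^{L}$ and $C\sqrt d\,\lambda^{L/2}$, respectively. 3. For fixed $A$, $B$, if the network is linear or $\mathcal P$ has no atoms, then for almost every $W$ the loss $\mathcal L$ is $C^\infty$ at $W$ and all gradient and Hessian blocks above are the ordinary partial derivatives of $\mathcal L$ at $W$. -/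

import Mathlib

open MeasureTheory ProbabilityTheory
open scoped Matrix

noncomputable section

/-- The two kinds of networks: linear (`φ t = t`) and ReLU (`φ t = max t 0`). -/
inductive Activation where
  | linear
  | relu

namespace Activation

/-- The non-linearity `φ`. -/
def apply : Activation → ℝ → ℝ
  | linear, t => t
  | relu, t => max t 0

/-- The activation gate at preactivation `t`, with the convention that a ReLU unit is off
at `t = 0`. -/
def gate : Activation → ℝ → ℝ
  | linear, _ => 1
  | relu, t => if 0 < t then 1 else 0

/-- `p = 1` for linear networks and `p = 1/2` for ReLU networks. -/
def p : Activation → ℝ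
  | linear => 1
  | relu => 1 / 2

/-- The factor in the constants for fixed input and output matrices: `1` for linear networks
and the width `d` for ReLU networks. -/
def widthFactor : Activation → ℕ → ℝ
  | linear, _ => 1
  | relu, d => d

theorem gate_mul_self (act : Activation) (t : ℝ) : act.gate t * t = act.apply t := by
  cases act with
  | linear => simp [gate, apply]
  | relu =>
    by_cases h : 0 < t
    · simp [gate, apply, h, h.le]
    · simp [gate, apply, h, not_lt.mp h]

end Activation

/-- The weights `W^1, …, W^L` (stored with indices `0, …, L - 1`), each of size `d × d`. -/
abbrev Weights (L d : ℕ) : Type := Fin L → Fin d → Fin d → ℝ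

/-- Euclidean norm of a vector. -/
def euclNorm {ι : Type*} [Fintype ι] (v : ι → ℝ) : ℝ := √(∑ i, v i ^ 2)

/-- Frobenius norm of a matrix. -/
def frobNorm {ι κ : Type*} [Fintype ι] [Fintype κ] (M : Matrix ι κ ℝ) : ℝ :=
  √(∑ i, ∑ j, M i j ^ 2)

section Network

variable {L d dIn dOut n : ℕ}

/-- The preactivation of layer `ℓ` of the network with first preactivation `z`:
`a^0 = z` and `a^{ℓ+1} = W^{ℓ+1} φ(a^ℓ)` for `ℓ < L` (the value for `ℓ > L` is never used). -/
def preact (act : Activation) (W : Weights L d) (z : Fin d → ℝ) : ℕ → Fin d → ℝ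
  | 0 => z
  | ℓ + 1 =>
    if h : ℓ < L then Matrix.of (W ⟨ℓ, h⟩) *ᵥ (fun i => act.apply (preact act W z ℓ i)) else 0

/-- The diagonals of the gate matrices `D^0, …, D^L` at the weights `W`. -/
def gates (act : Activation) (W : Weights L d) (z : Fin d → ℝ) (ℓ : ℕ) (i : Fin d) : ℝ :=
  act.gate (preact act W z ℓ i)

/-- The vector `W^ℓ D^{ℓ-1} W^{ℓ-1} ⋯ W^1 D^0 z` for prescribed gates `D`. -/
def gatedPreact (D : ℕ → Fin d → ℝ) (W : Weights L d) (z : Fin d → ℝ) : ℕ → Fin d → ℝ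
  | 0 => z
  | ℓ + 1 =>
    if h : ℓ < L then Matrix.of (W ⟨ℓ, h⟩) *ᵥ (fun i => D ℓ i * gatedPreact D W z ℓ i) else 0

/-- The loss `1/(2n) ∑ᵢ ‖yᵢ - B φ(a^L(xᵢ))‖²` of the network, as a function of the weights. -/
def loss (act : Activation) (A : Matrix (Fin d) (Fin dIn) ℝ) (B : Matrix (Fin dOut) (Fin d) ℝ)
    (x : Fin n → Fin dIn → ℝ) (y : Fin n → Fin dOut → ℝ) (W : Weights L d) : ℝ :=
  1 / (2 * (n : ℝ)) * ∑ s, euclNorm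
    (y s - B *ᵥ (fun i => act.apply (preact act W (A *ᵥ x s) L i))) ^ 2

/-- The loss `1/(2n) ∑ᵢ ‖yᵢ - B D^L V^L D^{L-1} ⋯ V^1 D^0 A xᵢ‖²` at the weights `V`, where the
gates `D^ℓ` (one family for each sample) are held at their values at the weights `W`. -/
def gatedLoss (act : Activation) (A : Matrix (Fin d) (Fin dIn) ℝ)
    (B : Matrix (Fin dOut) (Fin d) ℝ) (x : Fin n → Fin dIn → ℝ) (y : Fin n → Fin dOut → ℝ)
    (W V : Weights L d) : ℝ :=
  1 / (2 * (n : ℝ)) * ∑ s, euclNorm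
    (y s - B *ᵥ (fun i => gates act W (A *ᵥ x s) L i *
      gatedPreact (gates act W (A *ᵥ x s)) V (A *ᵥ x s) L i)) ^ 2

/-- The gated loss at the point where its gates are computed is the loss. -/
theorem gatedLoss_self (act : Activation) (A : Matrix (Fin d) (Fin dIn) ℝ)
    (B : Matrix (Fin dOut) (Fin d) ℝ) (x : Fin n → Fin dIn → ℝ) (y : Fin n → Fin dOut → ℝ)
    (W : Weights L d) : gatedLoss act A B x y W W = loss act A B x y W := by
  have key : ∀ (z : Fin d → ℝ) (ℓ : ℕ),
      gatedPreact (gates act W z) W z ℓ = preact act W z ℓ := by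
    intro z ℓ
    induction ℓ with
    | zero => rfl
    | succ m ih => simp only [gatedPreact, preact, ih, gates, Activation.gate_mul_self]
  simp only [gatedLoss, loss, key, gates, Activation.gate_mul_self]

/-- The unit perturbation of the entry `(i, j)` of the `k`-th weight matrix. -/
def unitWeight (k : Fin L) (i j : Fin d) : Weights L d :=
  Pi.single k (Pi.single i (Pi.single j 1))

/-- The gradient `∂f/∂W_k`, a `d × d` matrix. -/
def gradBlock (f : Weights L d → ℝ) (W : Weights L d) (k : Fin L) :
    Matrix (Fin d) (Fin d) ℝ :=
  Matrix.of fun i j => fderiv ℝ f W (unitWeight k i j)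

/-- The Hessian block `∂²f/∂W_k∂W_ℓ`, a `d² × d²` matrix. -/
def hessBlock (f : Weights L d → ℝ) (W : Weights L d) (k ℓ : Fin L) :
    Matrix (Fin d × Fin d) (Fin d × Fin d) ℝ :=
  Matrix.of fun a b =>
    fderiv ℝ (fun V => fderiv ℝ f V (unitWeight ℓ b.1 b.2)) W (unitWeight k a.1 a.2)

/-- Frobenius norm of the gradient of the loss with respect to `W_k` at `W`. For ReLU networks the
gates are treated as locally constant, as in backpropagation. -/
def gradNorm (act : Activation) (A : Matrix (Fin d) (Fin dIn) ℝ)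
    (B : Matrix (Fin dOut) (Fin d) ℝ) (x : Fin n → Fin dIn → ℝ) (y : Fin n → Fin dOut → ℝ)
    (W : Weights L d) (k : Fin L) : ℝ :=
  frobNorm (gradBlock (gatedLoss act A B x y W) W k)

/-- Frobenius norm of the block `(k, ℓ)` of the Hessian of the loss at `W`. For ReLU networks the
gates are treated as locally constant, as in backpropagation. -/
def hessNorm (act : Activation) (A : Matrix (Fin d) (Fin dIn) ℝ)
    (B : Matrix (Fin dOut) (Fin d) ℝ) (x : Fin n → Fin dIn → ℝ) (y : Fin n → Fin dOut → ℝ)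
    (W : Weights L d) (k ℓ : Fin L) : ℝ :=
  frobNorm (hessBlock (gatedLoss act A B x y W) W k ℓ)

end Network

/-- A probability distribution on `ℝ` that is symmetric around zero, with variance `σ²` and
finite fourth moment. -/
structure IsInitLaw (P : Measure ℝ) (σ : ℝ) : Prop where
  isProbabilityMeasure : IsProbabilityMeasure P
  symmetric : P.map (fun t => -t) = P
  memLp_four : MemLp id 4 P
  variance_eq : variance id P = σ ^ 2

/-- The law of the weights when all entries of all `W^ℓ` are i.i.d. of law `P`. -/
def initLaw (P : Measure ℝ) (L d : ℕ) : Measure (Weights L d) :=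
  Measure.pi fun _ : Fin L => Measure.pi fun _ : Fin d => Measure.pi fun _ : Fin d => P

/-- The joint law of the entries of `(A, B, (W^ℓ)_ℓ)` when all of them are i.i.d. of law `P`. -/
def jointLaw (P : Measure ℝ) (dIn dOut d L : ℕ) :
    Measure ((Fin d → Fin dIn → ℝ) × (Fin dOut → Fin d → ℝ) × Weights L d) :=
  (Measure.pi fun _ : Fin d => Measure.pi fun _ : Fin dIn => P).prod
    ((Measure.pi fun _ : Fin dOut => Measure.pi fun _ : Fin d => P).prod (initLaw P L d))

/-- `lam = p d σ²`. -/
def lam (act : Activation) (d : ℕ) (σ : ℝ) : ℝ := act.p * d * σ ^ 2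

end

/-! With the gates frozen, the output of the network is multilinear in the weight matrices and hence
affine in each single entry. The derivative of output `o` in the entry `(i, j)` of layer `k` is a
product: an entry of the part of the network above layer `k`, times a coordinate of the signal
arriving from below. The mixed second derivative for two layers has three such factors (above,
between, below), and it vanishes for two entries of the same layer. Squared Frobenius norms
therefore factorise exactly (`ampSq`, `ampSq₂`). Cauchy–Schwarz bounds the gradient by residual
times `√ampSq`, a diagonal Hessian block by `ampSq`, and an off-diagonal block by a Gram term plus
residual times `√ampSq₂`. A second Cauchy–Schwarz, in expectation, leaves only three second moments
to estimate (`expected_norms_le`).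

These come from integrating out layers from the top. Let `w` be a fresh symmetric row, `v` the
activation that drives its gate and `u` the vector being propagated. Flipping the sign of `w`
exchanges the events `w ⬝ᵥ v > 0` and `w ⬝ᵥ v < 0` and keeps `(w ⬝ᵥ u) ^ 2`, so the gate passes at
most half of the second moment, whatever `u` and `v` are (`IsInitLaw.lintegral_gate_row_sq_le`). One
layer thus costs a factor `λ`, uniformly in everything below it. This uniformity lets the factors of
a product be integrated successively, although the gates couple them
(`IsInitLaw.lintegral_chain_mulVec_le`). A Frobenius norm is a sum over `d` basis vectors, hence the
factor `d`. It disappears in front of a fixed `B` for linear networks, where the absence of gates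
makes the rows of the last layer uncorrelated.

For the almost sure statement, a law without atoms gives no mass to a hyperplane. So preactivations
of positive depth vanish only above a layer that is entirely off, and such a layer stays off nearby.
The gates are then locally constant, and the loss coincides with the gated loss near almost every
`W`. -/

noncomputable section

/-! ### Gated matrix products and exact derivatives of the gated loss. -/

section Chain

variable {L d dIn dOut n : ℕ}

/-- The weight matrix of layer `b`, zero if there is no such layer. -/
def layer (V : Weights L d) (b : ℕ) : Matrix (Fin d) (Fin d) ℝ :=
  if h : b < L then Matrix.of (V ⟨b, h⟩) else 0

/-- The product `D^b V_{b-1} D^{b-1} ⋯ V_a D^a` (and `D^b` if `b ≤ a`). -/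
def chain (D : ℕ → Fin d → ℝ) (V : Weights L d) (a : ℕ) : ℕ → Matrix (Fin d) (Fin d) ℝ
  | 0 => Matrix.diagonal (D 0)
  | b + 1 =>
    if a ≤ b then Matrix.diagonal (D (b + 1)) * (layer V b * chain D V a b)
    else Matrix.diagonal (D (b + 1))

theorem chain_self (D : ℕ → Fin d → ℝ) (V : Weights L d) (a : ℕ) :
    chain D V a a = Matrix.diagonal (D a) := by
  cases a <;> simp [chain]

theorem chain_succ (D : ℕ → Fin d → ℝ) (V : Weights L d) {a b : ℕ} (h : a ≤ b) :
    chain D V a (b + 1) = Matrix.diagonal (D (b + 1)) * (layer V b * chain D V a b) := by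
  simp [chain, h]

theorem chain_zero_mulVec (D : ℕ → Fin d → ℝ) (V : Weights L d) (z : Fin d → ℝ) (b : ℕ) :
    chain D V 0 b *ᵥ z = fun i => D b i * gatedPreact D V z b i := by
  induction b with
  | zero => ext i; simp [chain, gatedPreact, Matrix.mulVec_diagonal]
  | succ b ih =>
    ext i
    rw [chain_succ D V b.zero_le, ← Matrix.mulVec_mulVec, ← Matrix.mulVec_mulVec, ih,
      Matrix.mulVec_diagonal]
    by_cases h : b < L <;> simp [gatedPreact, layer, h]

/-- The factor `V_k` occurs exactly once in the product; isolating it is what makes the network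
affine in each layer. -/
theorem chain_split (D : ℕ → Fin d → ℝ) (V : Weights L d) {a k b : ℕ} (hak : a ≤ k) (hkb : k < b) :
    chain D V a b = chain D V (k + 1) b * layer V k * chain D V a k := by
  induction b, hkb using Nat.le_induction with
  | base => rw [chain_succ D V hak, chain_self, Matrix.mul_assoc]
  | succ b hb ih =>
    have hb' : k + 1 ≤ b := hb
    rw [chain_succ D V (by omega), chain_succ D V hb', ih]
    simp only [Matrix.mul_assoc]

theorem chain_congr (D : ℕ → Fin d → ℝ) {V V' : Weights L d} {a b : ℕ}
    (h : ∀ j, a ≤ j → j < b → layer V j = layer V' j) : chain D V a b = chain D V' a b := by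
  induction b with
  | zero => rfl
  | succ b ih =>
    by_cases hab : a ≤ b
    · rw [chain_succ _ _ hab, chain_succ _ _ hab, h b hab (by omega),
        ih fun j h1 h2 => h j h1 (by omega)]
    · simp [chain, hab]

theorem layer_add_smul_self (V : Weights L d) (k : Fin L) (i j : Fin d) (t : ℝ) :
    layer (V + t • unitWeight k i j) k = layer V k + t • Matrix.single i j 1 := by
  ext p q
  by_cases hp : p = i
  · subst hp
    by_cases hq : q = j
    · subst hq; simp [layer, unitWeight]
    · simp [layer, unitWeight, hq, Ne.symm hq]
  · simp [layer, unitWeight, hp, Ne.symm hp]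

theorem layer_add_smul_of_ne (V : Weights L d) (k : Fin L) (i j : Fin d) (t : ℝ) {b : ℕ}
    (h : b ≠ k) : layer (V + t • unitWeight k i j) b = layer V b := by
  by_cases hb : b < L
  · have : (⟨b, hb⟩ : Fin L) ≠ k := fun e => h (by rw [← e])
    ext p q
    simp [layer, unitWeight, hb, this]
  · simp [layer, hb]

theorem chain_add_smul_of_lt (D : ℕ → Fin d → ℝ) (V : Weights L d) (k : Fin L) (i j : Fin d)
    (t : ℝ) {a b : ℕ} (h : (k : ℕ) < a ∨ b ≤ k) :
    chain D (V + t • unitWeight k i j) a b = chain D V a b :=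
  chain_congr D fun m h1 h2 => layer_add_smul_of_ne V k i j t (by omega)

/-- The outer factors do not involve layer `k`, so the dependence on `t` is exactly affine, with a
rank-one slope. -/
theorem chain_add_smul (D : ℕ → Fin d → ℝ) (V : Weights L d) (k : Fin L) (i j : Fin d)
    (t : ℝ) {a b : ℕ} (hak : a ≤ k) (hkb : (k : ℕ) < b) :
    chain D (V + t • unitWeight k i j) a b =
      chain D V a b + t • (chain D V (k + 1) b * Matrix.single i j 1 * chain D V a k) := by
  rw [chain_split D _ hak hkb, chain_split D V hak hkb, layer_add_smul_self,
    chain_add_smul_of_lt D V k i j t (Or.inl (Nat.lt_succ_self _)),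
    chain_add_smul_of_lt D V k i j t (Or.inr le_rfl), Matrix.mul_add, Matrix.add_mul,
    Matrix.mul_smul, Matrix.smul_mul]

theorem contDiff_chain_apply (D : ℕ → Fin d → ℝ) (a b : ℕ) (i j : Fin d) :
    ContDiff ℝ (⊤ : ℕ∞) fun V : Weights L d => chain D V a b i j := by
  induction b generalizing i j with
  | zero => exact contDiff_const
  | succ b ih =>
    by_cases hab : a ≤ b
    · simp only [chain, if_pos hab, Matrix.diagonal_mul]
      simp only [Matrix.mul_apply, layer]
      refine contDiff_const.mul (ContDiff.sum fun k _ => ContDiff.mul ?_ (ih k j))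
      by_cases hb : b < L
      · simp only [hb, dite_true, Matrix.of_apply]
        fun_prop
      · simp only [hb, dite_false]
        exact contDiff_const
    · simp only [chain, if_neg hab]
      exact contDiff_const

/-- The quadratic loss of the networks with gates `D s` and first preactivations `z s`. -/
def chainLoss (B : Matrix (Fin dOut) (Fin d) ℝ) (D : Fin n → ℕ → Fin d → ℝ)
    (z : Fin n → Fin d → ℝ) (y : Fin n → Fin dOut → ℝ) (V : Weights L d) : ℝ :=
  1 / (2 * (n : ℝ)) * ∑ s, ∑ o, (y s o - (B *ᵥ (chain (D s) V 0 L *ᵥ z s)) o) ^ 2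

theorem gatedLoss_eq_chainLoss (act : Activation) (A : Matrix (Fin d) (Fin dIn) ℝ)
    (B : Matrix (Fin dOut) (Fin d) ℝ) (x : Fin n → Fin dIn → ℝ) (y : Fin n → Fin dOut → ℝ)
    (W : Weights L d) :
    gatedLoss act A B x y W =
      chainLoss B (fun s => gates act W (A *ᵥ x s)) (fun s => A *ᵥ x s) y := by
  ext V
  simp only [gatedLoss, chainLoss, chain_zero_mulVec, euclNorm]
  congr 1
  refine Finset.sum_congr rfl fun s _ => ?_
  rw [Real.sq_sqrt (Finset.sum_nonneg fun _ _ => sq_nonneg _)]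
  rfl

theorem contDiff_mulVec_chain (B : Matrix (Fin dOut) (Fin d) ℝ) (D : ℕ → Fin d → ℝ)
    (z : Fin d → ℝ) (a b : ℕ) (o : Fin dOut) :
    ContDiff ℝ (⊤ : ℕ∞) fun V : Weights L d => (B *ᵥ (chain D V a b *ᵥ z)) o := by
  have := contDiff_chain_apply (L := L) D a b
  simp only [Matrix.mulVec, dotProduct]
  fun_prop

theorem contDiff_mul_chain (B : Matrix (Fin dOut) (Fin d) ℝ) (D : ℕ → Fin d → ℝ)
    (a b : ℕ) (o : Fin dOut) (i : Fin d) :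
    ContDiff ℝ (⊤ : ℕ∞) fun V : Weights L d => (B * chain D V a b) o i := by
  have := contDiff_chain_apply (L := L) D a b
  simp only [Matrix.mul_apply]
  fun_prop

theorem contDiff_chain_mulVec (D : ℕ → Fin d → ℝ)
    (z : Fin d → ℝ) (a b : ℕ) (i : Fin d) :
    ContDiff ℝ (⊤ : ℕ∞) fun V : Weights L d => (chain D V a b *ᵥ z) i := by
  have := contDiff_chain_apply (L := L) D a b
  simp only [Matrix.mulVec, dotProduct]
  fun_prop

theorem contDiff_chainLoss (B : Matrix (Fin dOut) (Fin d) ℝ) (D : Fin n → ℕ → Fin d → ℝ)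
    (z : Fin n → Fin d → ℝ) (y : Fin n → Fin dOut → ℝ) :
    ContDiff ℝ (⊤ : ℕ∞) (chainLoss (L := L) B D z y) := by
  have := fun s => contDiff_mulVec_chain (L := L) B (D s) (z s) 0 L
  unfold chainLoss
  fun_prop

/-- The derivative of output `o` in the direction of the entry `(i, j)` of the `k`-th weight
matrix. -/
def outDeriv (B : Matrix (Fin dOut) (Fin d) ℝ) (D : ℕ → Fin d → ℝ) (z : Fin d → ℝ)
    (V : Weights L d) (k : ℕ) (i j : Fin d) (o : Fin dOut) : ℝ :=
  (B * chain D V (k + 1) L) o i * (chain D V 0 k *ᵥ z) j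

/-- The second derivative of output `o` in the directions of the entry `(i, j)` of the `k`-th
and `(i', j')` of the `l`-th weight matrix, for `k < l`. -/
def outDeriv₂ (B : Matrix (Fin dOut) (Fin d) ℝ) (D : ℕ → Fin d → ℝ) (z : Fin d → ℝ)
    (V : Weights L d) (k l : ℕ) (i j i' j' : Fin d) (o : Fin dOut) : ℝ :=
  (B * chain D V (l + 1) L) o i' * (chain D V (k + 1) l j' i * (chain D V 0 k *ᵥ z) j)

theorem mul_single_mul_apply {α β : Type*} (M : Matrix α (Fin d) ℝ) (N : Matrix (Fin d) β ℝ)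
    (i j : Fin d) (p : α) (q : β) :
    (M * Matrix.single i j (1 : ℝ) * N) p q = M p i * N j q := by
  rw [Matrix.mul_apply, Finset.sum_eq_single j]
  · simp
  · intro b _ hb
    simp [Matrix.mul_apply, hb.symm]
  · simp

theorem mul_single_mul_mulVec {α : Type*} (M : Matrix α (Fin d) ℝ) (N : Matrix (Fin d) (Fin d) ℝ)
    (i j : Fin d) (z : Fin d → ℝ) (p : α) :
    ((M * Matrix.single i j (1 : ℝ) * N) *ᵥ z) p = M p i * (N *ᵥ z) j := by
  simp only [Matrix.mulVec, dotProduct, mul_single_mul_apply, Finset.mul_sum, mul_assoc]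

theorem out_add_smul (B : Matrix (Fin dOut) (Fin d) ℝ) (D : ℕ → Fin d → ℝ) (z : Fin d → ℝ)
    (V : Weights L d) (k : Fin L) (i j : Fin d) (o : Fin dOut) (t : ℝ) :
    (B *ᵥ (chain D (V + t • unitWeight k i j) 0 L *ᵥ z)) o =
      (B *ᵥ (chain D V 0 L *ᵥ z)) o + t * outDeriv B D z V k i j o := by
  rw [chain_add_smul D V k i j t (Nat.zero_le _) k.2]
  rw [Matrix.add_mulVec, Matrix.mulVec_add, Matrix.smul_mulVec, Matrix.mulVec_smul,
    Matrix.mulVec_mulVec (v := z) (N := chain D V (k + 1) L * _ * _), ← Matrix.mul_assoc,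
    ← Matrix.mul_assoc, Pi.add_apply, Pi.smul_apply, mul_single_mul_mulVec]
  rfl

/-- The derivative in layer `k` skips `V_k`. This is why diagonal Hessian blocks contain only the
Gram term and no residual. -/
theorem outDeriv_add_smul_self (B : Matrix (Fin dOut) (Fin d) ℝ) (D : ℕ → Fin d → ℝ)
    (z : Fin d → ℝ) (V : Weights L d) (k : Fin L) (i j i' j' : Fin d) (o : Fin dOut) (t : ℝ) :
    outDeriv B D z (V + t • unitWeight k i j) k i' j' o = outDeriv B D z V k i' j' o := by
  unfold outDeriv
  rw [chain_add_smul_of_lt D V k i j t (Or.inl (Nat.lt_succ_self _)),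
    chain_add_smul_of_lt D V k i j t (Or.inr le_rfl)]

/-- A change in a lower layer reaches the derivative in layer `l` only through the signal arriving
from below. -/
theorem outDeriv_add_smul_of_lt (B : Matrix (Fin dOut) (Fin d) ℝ) (D : ℕ → Fin d → ℝ)
    (z : Fin d → ℝ) (V : Weights L d) {k l : Fin L} (h : k < l) (i j i' j' : Fin d)
    (o : Fin dOut) (t : ℝ) :
    outDeriv B D z (V + t • unitWeight k i j) l i' j' o =
      outDeriv B D z V l i' j' o + t * outDeriv₂ B D z V k l i j i' j' o := by
  have h' : (k : ℕ) < l := h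
  unfold outDeriv outDeriv₂
  rw [chain_add_smul_of_lt D V k i j t (a := l + 1) (Or.inl (by omega)),
    chain_add_smul D V k i j t (Nat.zero_le _) h']
  rw [Matrix.add_mulVec, Matrix.smul_mulVec, Pi.add_apply, Pi.smul_apply, mul_single_mul_mulVec,
    smul_eq_mul]
  ring

/-- Here the change enters through the factor above layer `l`. The slope is the same `outDeriv₂`
with the two entries exchanged, which gives the symmetry of the Hessian. -/
theorem outDeriv_add_smul_of_gt (B : Matrix (Fin dOut) (Fin d) ℝ) (D : ℕ → Fin d → ℝ)
    (z : Fin d → ℝ) (V : Weights L d) {k l : Fin L} (h : l < k) (i j i' j' : Fin d)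
    (o : Fin dOut) (t : ℝ) :
    outDeriv B D z (V + t • unitWeight k i j) l i' j' o =
      outDeriv B D z V l i' j' o + t * outDeriv₂ B D z V l k i' j' i j o := by
  have h' : (l : ℕ) < k := h
  unfold outDeriv outDeriv₂
  rw [chain_add_smul_of_lt D V k i j t (a := 0) (Or.inr (by omega)),
    chain_add_smul D V k i j t (a := l + 1) h' k.2]
  rw [Matrix.mul_add, Matrix.mul_smul, Matrix.add_apply, Matrix.smul_apply, ← Matrix.mul_assoc,
    ← Matrix.mul_assoc, mul_single_mul_apply, smul_eq_mul]
  ring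

/-- Reduces Fréchet derivatives to one-variable calculus along coordinate lines, where the output is
affine. -/
theorem fderiv_apply_eq_of_hasDerivAt {E : Type*} [NormedAddCommGroup E] [NormedSpace ℝ E]
    {f : E → ℝ} {V v : E} {c : ℝ} (hf : DifferentiableAt ℝ f V)
    (h : HasDerivAt (fun t : ℝ => f (V + t • v)) c 0) : fderiv ℝ f V v = c :=
  (hf.hasFDerivAt.hasLineDerivAt v).unique h

theorem fderiv_chainLoss (B : Matrix (Fin dOut) (Fin d) ℝ) (D : Fin n → ℕ → Fin d → ℝ)
    (z : Fin n → Fin d → ℝ) (y : Fin n → Fin dOut → ℝ) (V : Weights L d) (k : Fin L)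
    (i j : Fin d) :
    fderiv ℝ (chainLoss B D z y) V (unitWeight k i j) =
      1 / (n : ℝ) * ∑ s, ∑ o, ((B *ᵥ (chain (D s) V 0 L *ᵥ z s)) o - y s o) *
        outDeriv B (D s) (z s) V k i j o := by
  refine fderiv_apply_eq_of_hasDerivAt
    ((contDiff_chainLoss B D z y).differentiable (by simp)).differentiableAt ?_
  simp only [chainLoss, out_add_smul]
  have key : ∀ s o, HasDerivAt (fun t : ℝ => (y s o - ((B *ᵥ (chain (D s) V 0 L *ᵥ z s)) o +
      t * outDeriv B (D s) (z s) V k i j o)) ^ 2)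
      (2 * (((B *ᵥ (chain (D s) V 0 L *ᵥ z s)) o - y s o) *
        outDeriv B (D s) (z s) V k i j o)) 0 := by
    intro s o
    have h1 := ((((hasDerivAt_id (0 : ℝ)).mul_const
      (outDeriv B (D s) (z s) V k i j o)).const_add
      ((B *ᵥ (chain (D s) V 0 L *ᵥ z s)) o)).const_sub (y s o)).pow 2
    refine h1.congr_deriv ?_
    simp
    ring
  have h2 := (HasDerivAt.fun_sum fun s (_ : s ∈ Finset.univ) =>
    HasDerivAt.fun_sum fun o (_ : o ∈ Finset.univ) => key s o).const_mul (1 / (2 * (n : ℝ)))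
  refine h2.congr_deriv ?_
  simp only [← Finset.mul_sum]
  -- Without samples both prefactors are `1 / 0 = 0`.
  rcases eq_or_ne (n : ℝ) 0 with hn | hn
  · simp [hn]
  · field_simp

theorem contDiff_outDeriv (B : Matrix (Fin dOut) (Fin d) ℝ) (D : ℕ → Fin d → ℝ)
    (z : Fin d → ℝ) (k : ℕ) (i j : Fin d) (o : Fin dOut) :
    ContDiff ℝ (⊤ : ℕ∞) fun V : Weights L d => outDeriv B D z V k i j o :=
  (contDiff_mul_chain B D _ _ o i).mul (contDiff_chain_mulVec D z _ _ j)

/-- The slope `c` is left open so that one product rule serves all relative positions of the two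
layers. -/
theorem fderiv_fderiv_chainLoss (B : Matrix (Fin dOut) (Fin d) ℝ) (D : Fin n → ℕ → Fin d → ℝ)
    (z : Fin n → Fin d → ℝ) (y : Fin n → Fin dOut → ℝ) (W : Weights L d) (k l : Fin L)
    (i j i' j' : Fin d) (c : Fin n → Fin dOut → ℝ)
    (hc : ∀ s o (t : ℝ), outDeriv B (D s) (z s) (W + t • unitWeight k i j) l i' j' o =
      outDeriv B (D s) (z s) W l i' j' o + t * c s o) :
    fderiv ℝ (fun V => fderiv ℝ (chainLoss B D z y) V (unitWeight l i' j')) W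
        (unitWeight k i j) =
      1 / (n : ℝ) * ∑ s, ∑ o, (outDeriv B (D s) (z s) W k i j o *
        outDeriv B (D s) (z s) W l i' j' o +
        ((B *ᵥ (chain (D s) W 0 L *ᵥ z s)) o - y s o) * c s o) := by
  simp only [fderiv_chainLoss]
  refine fderiv_apply_eq_of_hasDerivAt ?_ ?_
  · have h1 := fun s => contDiff_mulVec_chain (L := L) B (D s) (z s) 0 L
    have h2 := fun s => contDiff_outDeriv (L := L) B (D s) (z s) l i' j'
    refine ContDiff.differentiable (n := (⊤ : ℕ∞)) ?_ (by simp) |>.differentiableAt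
    fun_prop
  simp only [hc, out_add_smul]
  refine HasDerivAt.const_mul _ (HasDerivAt.fun_sum fun s _ => HasDerivAt.fun_sum fun o _ => ?_)
  have h1 := (((hasDerivAt_id (0 : ℝ)).mul_const
      (outDeriv B (D s) (z s) W k i j o)).const_add
      ((B *ᵥ (chain (D s) W 0 L *ᵥ z s)) o)).sub_const (y s o)
  have h2 := ((hasDerivAt_id (0 : ℝ)).mul_const (c s o)).const_add
      (outDeriv B (D s) (z s) W l i' j' o)
  refine (h1.mul h2).congr_deriv ?_
  simp

end Chain

/-! ### Euclidean and Frobenius norms, and Cauchy–Schwarz for matrices of scalar products. -/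

section Norms

variable {ι κ τ : Type*} [Fintype ι] [Fintype κ] [Fintype τ]

/-- The squared Euclidean norm. -/
def sqSum (v : ι → ℝ) : ℝ := ∑ i, v i ^ 2

/-- The squared Frobenius norm. -/
def frobSq (M : Matrix ι κ ℝ) : ℝ := ∑ i, ∑ j, M i j ^ 2

theorem sqSum_nonneg (v : ι → ℝ) : 0 ≤ sqSum v := Finset.sum_nonneg fun _ _ => sq_nonneg _

theorem frobSq_nonneg (M : Matrix ι κ ℝ) : 0 ≤ frobSq M :=
  Finset.sum_nonneg fun _ _ => Finset.sum_nonneg fun _ _ => sq_nonneg _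

theorem frobSq_eq_sum_col (M : Matrix ι κ ℝ) : frobSq M = ∑ j, sqSum fun i => M i j :=
  Finset.sum_comm

theorem euclNorm_eq_norm (v : ι → ℝ) : euclNorm v = ‖WithLp.toLp 2 v‖ := by
  simp [euclNorm, EuclideanSpace.norm_eq]

theorem euclNorm_nonneg (v : ι → ℝ) : 0 ≤ euclNorm v := Real.sqrt_nonneg _

theorem frobNorm_nonneg (M : Matrix ι κ ℝ) : 0 ≤ frobNorm M := Real.sqrt_nonneg _

theorem euclNorm_sub_le (v w : ι → ℝ) : euclNorm (v - w) ≤ euclNorm v + euclNorm w := by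
  simp only [euclNorm_eq_norm, WithLp.toLp_sub]
  exact norm_sub_le _ _

/-- Imports the triangle inequality and homogeneity from Euclidean space. -/
theorem frobNorm_eq_norm (M : Matrix ι κ ℝ) :
    frobNorm M = ‖WithLp.toLp 2 (fun p : ι × κ => M p.1 p.2)‖ := by
  simp [frobNorm, EuclideanSpace.norm_eq, Fintype.sum_prod_type]

theorem frobNorm_add_le (M N : Matrix ι κ ℝ) : frobNorm (M + N) ≤ frobNorm M + frobNorm N := by
  simp only [frobNorm_eq_norm]
  exact norm_add_le (WithLp.toLp 2 (fun p : ι × κ => M p.1 p.2))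
    (WithLp.toLp 2 (fun p : ι × κ => N p.1 p.2))

theorem frobNorm_smul (c : ℝ) (M : Matrix ι κ ℝ) : frobNorm (c • M) = |c| * frobNorm M := by
  simp only [frobNorm_eq_norm]
  exact norm_smul c (WithLp.toLp 2 (fun p : ι × κ => M p.1 p.2))

theorem frobNorm_sum_le {n : ℕ} (M : Fin n → Matrix ι κ ℝ) :
    frobNorm (∑ s, M s) ≤ ∑ s, frobNorm (M s) := by
  refine Finset.le_sum_of_subadditive frobNorm ?_ frobNorm_add_le _ _
  simp [frobNorm]

theorem frobNorm_mean_le {n : ℕ} (M : Fin n → Matrix ι κ ℝ) (K : Fin n → ℝ)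
    (h : ∀ s, frobNorm (M s) ≤ K s) :
    frobNorm ((1 / (n : ℝ)) • ∑ s, M s) ≤ 1 / (n : ℝ) * ∑ s, K s := by
  rw [frobNorm_smul, abs_of_nonneg (by positivity)]
  exact mul_le_mul_of_nonneg_left
    ((frobNorm_sum_le M).trans (Finset.sum_le_sum fun s _ => h s)) (by positivity)

/-- Cauchy–Schwarz for a matrix of scalar products with a fixed vector. -/
theorem frobNorm_dotProduct_le (r : τ → ℝ) (T : ι → κ → τ → ℝ) :
    frobNorm (Matrix.of fun i j => ∑ o, r o * T i j o) ≤
      √(sqSum r) * √(∑ i, ∑ j, ∑ o, T i j o ^ 2) := by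
  rw [← Real.sqrt_mul (sqSum_nonneg r), Finset.mul_sum]
  refine Real.sqrt_le_sqrt (Finset.sum_le_sum fun i _ => ?_)
  rw [Finset.mul_sum]
  exact Finset.sum_le_sum fun j _ => Finset.sum_mul_sq_le_sq_mul_sq _ _ _

/-- Cauchy–Schwarz for a Gram matrix. -/
theorem frobNorm_gram_le (S : ι → τ → ℝ) (T : κ → τ → ℝ) :
    frobNorm (Matrix.of fun i j => ∑ o, S i o * T j o) ≤
      √(∑ i, ∑ o, S i o ^ 2) * √(∑ j, ∑ o, T j o ^ 2) := by
  rw [← Real.sqrt_mul (show 0 ≤ ∑ i, ∑ o, S i o ^ 2 from frobSq_nonneg S), Finset.sum_mul]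
  refine Real.sqrt_le_sqrt (Finset.sum_le_sum fun i _ => ?_)
  rw [Finset.mul_sum]
  exact Finset.sum_le_sum fun j _ => Finset.sum_mul_sq_le_sq_mul_sq _ _ _

theorem sqSum_mulVec_le (B : Matrix ι κ ℝ) (v : κ → ℝ) :
    sqSum (B *ᵥ v) ≤ frobSq B * sqSum v := by
  rw [frobSq, Finset.sum_mul]
  exact Finset.sum_le_sum fun i _ => Finset.sum_mul_sq_le_sq_mul_sq _ _ _

theorem frobSq_mul_le (B : Matrix ι κ ℝ) (M : Matrix κ τ ℝ) :
    frobSq (B * M) ≤ frobSq B * frobSq M := by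
  rw [frobSq_eq_sum_col, frobSq_eq_sum_col M, Finset.mul_sum]
  exact Finset.sum_le_sum fun j _ => sqSum_mulVec_le B fun i => M i j

end Norms

/-! ### Pointwise bounds on the gradient and Hessian blocks. -/

section Bounds

variable {L d dIn dOut n : ℕ}

/-- The squared Frobenius norm of the derivative of the output with respect to the `k`-th weight
matrix. -/
def ampSq (act : Activation) (B : Matrix (Fin dOut) (Fin d) ℝ) (z : Fin d → ℝ) (W : Weights L d)
    (k : ℕ) : ℝ :=
  frobSq (B * chain (gates act W z) W (k + 1) L) * sqSum (chain (gates act W z) W 0 k *ᵥ z)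

/-- The squared Frobenius norm of the mixed second derivative of the output with respect to the
`k`-th and `l`-th weight matrix, for `k < l`. -/
def ampSq₂ (act : Activation) (B : Matrix (Fin dOut) (Fin d) ℝ) (z : Fin d → ℝ) (W : Weights L d)
    (k l : ℕ) : ℝ :=
  frobSq (B * chain (gates act W z) W (l + 1) L) *
    (frobSq (chain (gates act W z) W (k + 1) l) * sqSum (chain (gates act W z) W 0 k *ᵥ z))

/-- The output of the network. -/
def netOut (act : Activation) (B : Matrix (Fin dOut) (Fin d) ℝ) (z : Fin d → ℝ)
    (W : Weights L d) : Fin dOut → ℝ :=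
  B *ᵥ (chain (gates act W z) W 0 L *ᵥ z)

/-- Each term is a function of `(o, i)` times a function of `j`, so the sum of squares splits into
two norms. -/
theorem sum_outDeriv_sq (act : Activation) (B : Matrix (Fin dOut) (Fin d) ℝ) (z : Fin d → ℝ)
    (W : Weights L d) (k : ℕ) :
    ∑ i, ∑ j, ∑ o, outDeriv B (gates act W z) z W k i j o ^ 2 = ampSq act B z W k := by
  simp only [outDeriv, mul_pow, ampSq, frobSq_eq_sum_col, sqSum, ← Finset.sum_mul,
    ← Finset.mul_sum]

theorem sum_outDeriv₂_sq (act : Activation) (B : Matrix (Fin dOut) (Fin d) ℝ) (z : Fin d → ℝ)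
    (W : Weights L d) (k l : ℕ) :
    ∑ i, ∑ j, ∑ i', ∑ j', ∑ o, outDeriv₂ B (gates act W z) z W k l i j i' j' o ^ 2 =
      ampSq₂ act B z W k l := by
  simp only [outDeriv₂, mul_pow, ampSq₂, frobSq_eq_sum_col, sqSum, ← Finset.sum_mul,
    ← Finset.mul_sum]

theorem gradBlock_eq (act : Activation) (A : Matrix (Fin d) (Fin dIn) ℝ)
    (B : Matrix (Fin dOut) (Fin d) ℝ) (x : Fin n → Fin dIn → ℝ) (y : Fin n → Fin dOut → ℝ)
    (W : Weights L d) (k : Fin L) :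
    gradBlock (gatedLoss act A B x y W) W k = (1 / (n : ℝ)) • ∑ s,
      Matrix.of fun i j => ∑ o, (netOut act B (A *ᵥ x s) W - y s) o *
        outDeriv B (gates act W (A *ᵥ x s)) (A *ᵥ x s) W k i j o := by
  ext i j
  simp only [gradBlock, Matrix.of_apply, gatedLoss_eq_chainLoss, fderiv_chainLoss,
    Matrix.smul_apply, Matrix.sum_apply, smul_eq_mul, netOut, Pi.sub_apply]

theorem hessBlock_self_eq (act : Activation) (A : Matrix (Fin d) (Fin dIn) ℝ)
    (B : Matrix (Fin dOut) (Fin d) ℝ) (x : Fin n → Fin dIn → ℝ) (y : Fin n → Fin dOut → ℝ)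
    (W : Weights L d) (k : Fin L) :
    hessBlock (gatedLoss act A B x y W) W k k = (1 / (n : ℝ)) • ∑ s,
      Matrix.of fun a b : Fin d × Fin d => ∑ o,
        outDeriv B (gates act W (A *ᵥ x s)) (A *ᵥ x s) W k a.1 a.2 o *
        outDeriv B (gates act W (A *ᵥ x s)) (A *ᵥ x s) W k b.1 b.2 o := by
  ext a b
  simp only [hessBlock, Matrix.of_apply, gatedLoss_eq_chainLoss,
    Matrix.smul_apply, Matrix.sum_apply, smul_eq_mul]
  rw [fderiv_fderiv_chainLoss (c := fun _ _ => 0)]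
  · simp
  · intro s o t
    rw [outDeriv_add_smul_self]; simp

theorem hessBlock_eq_of_lt (act : Activation) (A : Matrix (Fin d) (Fin dIn) ℝ)
    (B : Matrix (Fin dOut) (Fin d) ℝ) (x : Fin n → Fin dIn → ℝ) (y : Fin n → Fin dOut → ℝ)
    (W : Weights L d) {k l : Fin L} (hkl : k < l) :
    hessBlock (gatedLoss act A B x y W) W k l = (1 / (n : ℝ)) • ∑ s,
      ((Matrix.of fun a b : Fin d × Fin d => ∑ o,
        outDeriv B (gates act W (A *ᵥ x s)) (A *ᵥ x s) W k a.1 a.2 o *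
        outDeriv B (gates act W (A *ᵥ x s)) (A *ᵥ x s) W l b.1 b.2 o) +
      Matrix.of fun a b : Fin d × Fin d => ∑ o, (netOut act B (A *ᵥ x s) W - y s) o *
        outDeriv₂ B (gates act W (A *ᵥ x s)) (A *ᵥ x s) W k l a.1 a.2 b.1 b.2 o) := by
  ext a b
  simp only [hessBlock, Matrix.of_apply, gatedLoss_eq_chainLoss, Matrix.add_apply,
    Matrix.smul_apply, Matrix.sum_apply, smul_eq_mul, ← Finset.sum_add_distrib]
  rw [fderiv_fderiv_chainLoss _ _ _ _ _ _ _ _ _ _ _ _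
    fun s o t => outDeriv_add_smul_of_lt _ _ _ _ hkl _ _ _ _ _ _]
  rfl

theorem gradNorm_le (act : Activation) (A : Matrix (Fin d) (Fin dIn) ℝ)
    (B : Matrix (Fin dOut) (Fin d) ℝ) (x : Fin n → Fin dIn → ℝ) (y : Fin n → Fin dOut → ℝ)
    (W : Weights L d) (k : Fin L) :
    gradNorm act A B x y W k ≤ 1 / (n : ℝ) * ∑ s,
      (euclNorm (netOut act B (A *ᵥ x s) W) + euclNorm (y s)) * √(ampSq act B (A *ᵥ x s) W k) := by
  rw [gradNorm, gradBlock_eq]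
  refine frobNorm_mean_le _ _ fun s => (frobNorm_dotProduct_le _ _).trans ?_
  rw [sum_outDeriv_sq]
  exact mul_le_mul_of_nonneg_right (euclNorm_sub_le _ _) (Real.sqrt_nonneg _)

theorem frobNorm_gram_outDeriv_le (act : Activation) (B : Matrix (Fin dOut) (Fin d) ℝ)
    (z : Fin d → ℝ) (W : Weights L d) (k l : ℕ) :
    frobNorm (Matrix.of fun a b : Fin d × Fin d => ∑ o,
        outDeriv B (gates act W z) z W k a.1 a.2 o * outDeriv B (gates act W z) z W l b.1 b.2 o) ≤
      √(ampSq act B z W k) * √(ampSq act B z W l) := by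
  refine (frobNorm_gram_le (fun (a : Fin d × Fin d) o => outDeriv B (gates act W z) z W k a.1 a.2 o)
    (fun (b : Fin d × Fin d) o => outDeriv B (gates act W z) z W l b.1 b.2 o)).trans_eq ?_
  simp only [Fintype.sum_prod_type, sum_outDeriv_sq]

theorem hessNorm_self_le (act : Activation) (A : Matrix (Fin d) (Fin dIn) ℝ)
    (B : Matrix (Fin dOut) (Fin d) ℝ) (x : Fin n → Fin dIn → ℝ) (y : Fin n → Fin dOut → ℝ)
    (W : Weights L d) (k : Fin L) :
    hessNorm act A B x y W k k ≤ 1 / (n : ℝ) * ∑ s,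
      √(ampSq act B (A *ᵥ x s) W k) * √(ampSq act B (A *ᵥ x s) W k) := by
  rw [hessNorm, hessBlock_self_eq]
  exact frobNorm_mean_le _ _ fun s => frobNorm_gram_outDeriv_le act B (A *ᵥ x s) W k k

theorem hessNorm_le_of_lt (act : Activation) (A : Matrix (Fin d) (Fin dIn) ℝ)
    (B : Matrix (Fin dOut) (Fin d) ℝ) (x : Fin n → Fin dIn → ℝ) (y : Fin n → Fin dOut → ℝ)
    (W : Weights L d) {k l : Fin L} (hkl : k < l) :
    hessNorm act A B x y W k l ≤ 1 / (n : ℝ) * ∑ s,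
      (√(ampSq act B (A *ᵥ x s) W k) * √(ampSq act B (A *ᵥ x s) W l) +
        (euclNorm (netOut act B (A *ᵥ x s) W) + euclNorm (y s)) *
          √(ampSq₂ act B (A *ᵥ x s) W k l)) := by
  rw [hessNorm, hessBlock_eq_of_lt _ _ _ _ _ _ hkl]
  refine frobNorm_mean_le _ _ fun s => (frobNorm_add_le _ _).trans (add_le_add
    (frobNorm_gram_outDeriv_le act B (A *ᵥ x s) W k l) ((frobNorm_dotProduct_le _
      fun (a b : Fin d × Fin d) o => outDeriv₂ B (gates act W (A *ᵥ x s)) (A *ᵥ x s) W k l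
        a.1 a.2 b.1 b.2 o).trans ?_))
  simp only [Fintype.sum_prod_type, sum_outDeriv₂_sq]
  exact mul_le_mul_of_nonneg_right (euclNorm_sub_le _ _) (Real.sqrt_nonneg _)

theorem frobNorm_transpose {ι κ : Type*} [Fintype ι] [Fintype κ] (M : Matrix ι κ ℝ) :
    frobNorm Mᵀ = frobNorm M := by
  unfold frobNorm
  rw [Finset.sum_comm]
  rfl

/-- Transposition exchanges the two explicit formulas, so that later only `k < l` has to be treated.
-/
theorem hessNorm_comm (act : Activation) (A : Matrix (Fin d) (Fin dIn) ℝ)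
    (B : Matrix (Fin dOut) (Fin d) ℝ) (x : Fin n → Fin dIn → ℝ) (y : Fin n → Fin dOut → ℝ)
    (W : Weights L d) (k l : Fin L) :
    hessNorm act A B x y W k l = hessNorm act A B x y W l k := by
  wlog hkl : k < l generalizing k l
  · rcases eq_or_lt_of_le (not_lt.mp hkl) with rfl | h
    · rfl
    · exact (this l k h).symm
  rw [hessNorm, hessNorm, ← frobNorm_transpose]
  congr 1
  ext a b
  simp only [hessBlock, Matrix.of_apply, gatedLoss_eq_chainLoss, Matrix.transpose_apply]
  rw [fderiv_fderiv_chainLoss _ _ _ _ _ _ _ _ _ _ _ _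
      fun s o t => outDeriv_add_smul_of_lt _ _ _ _ hkl _ _ _ _ _ _,
    fderiv_fderiv_chainLoss _ _ _ _ _ _ _ _ _ _ _ _
      fun s o t => outDeriv_add_smul_of_gt _ _ _ _ hkl _ _ _ _ _ _]
  simp only [mul_comm (outDeriv B _ _ W k _ _ _)]

end Bounds

open scoped ENNReal

/-! ### Resampling a coordinate of a product measure. -/

section Resample

variable {ι : Type*} [Fintype ι] [DecidableEq ι] {X : ι → Type*} [∀ i, MeasurableSpace (X i)]

/-- Resampling one coordinate of a product measure. -/
theorem lintegral_pi_update (μ : ∀ i, Measure (X i)) [∀ i, IsProbabilityMeasure (μ i)]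
    {f : (∀ i, X i) → ℝ≥0∞} (hf : Measurable f) (k : ι) :
    ∫⁻ x, f x ∂Measure.pi μ =
      ∫⁻ x, ∫⁻ w, f (Function.update x k w) ∂μ k ∂Measure.pi μ := by
  obtain ⟨x₀⟩ : Nonempty (∀ i, X i) := (Measure.pi μ).nonempty_of_neZero
  have hG : Measurable fun x => ∫⁻ w, f (Function.update x k w) ∂μ k :=
    Measurable.lintegral_prod_right' (f := fun p : (∀ i, X i) × X k => f (Function.update p.1 k p.2))
      (hf.comp measurable_update')
  -- Coordinate `k` is integrated out first on both sides. On the right the integrand no longer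
  -- depends on it, and `μ k` has mass one.
  rw [lintegral_eq_lmarginal_univ x₀, lintegral_eq_lmarginal_univ x₀,
    lmarginal_erase' f hf (Finset.mem_univ k), lmarginal_erase' _ hG (Finset.mem_univ k)]
  simp

end Resample

/-! ### Second moments of sums of independent centred variables. -/

section Moments

variable {P : Measure ℝ} {σ : ℝ}

theorem IsInitLaw.memLp_two (hP : IsInitLaw P σ) : MemLp id 2 P :=
  have := hP.isProbabilityMeasure
  hP.memLp_four.mono_exponent (by norm_num)

theorem IsInitLaw.integral_eq_zero (hP : IsInitLaw P σ) : ∫ t, t ∂P = 0 := by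
  have h : ∫ t, t ∂P = ∫ t, -t ∂P := by
    conv_lhs => rw [← hP.symmetric]
    rw [integral_map measurable_neg.aemeasurable (by fun_prop)]
  rw [integral_neg] at h
  linarith

/-- Converts second moments into variances, which add over independent coordinates; the Lebesgue
integral suits later resampling. -/
theorem lintegral_ofReal_sq_eq_variance {Ω : Type*} [MeasurableSpace Ω] {μ : Measure Ω}
    {X : Ω → ℝ} (hX : MemLp X 2 μ) (h0 : ∫ ω, X ω ∂μ = 0) :
    ∫⁻ ω, ENNReal.ofReal (X ω ^ 2) ∂μ = ENNReal.ofReal (variance X μ) := by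
  rw [variance_of_integral_eq_zero hX.aestronglyMeasurable.aemeasurable h0,
    ofReal_integral_eq_lintegral_ofReal hX.integrable_sq (ae_of_all _ fun _ => sq_nonneg _)]

variable {ι : Type*} [Fintype ι] {Ω : Type*} [MeasurableSpace Ω] (μ : Measure Ω)
  [IsProbabilityMeasure μ]

theorem memLp_pi_sum {X : ι → Ω → ℝ} (hX : ∀ i, MemLp (X i) 2 μ) :
    MemLp (fun ω : ι → Ω => ∑ i, X i (ω i)) 2 (Measure.pi fun _ => μ) :=
  memLp_finsetSum _ fun i _ => (hX i).comp_measurePreserving (measurePreserving_eval _ i)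

theorem integral_pi_sum_eq_zero {X : ι → Ω → ℝ} (hX : ∀ i, MemLp (X i) 2 μ)
    (h0 : ∀ i, ∫ t, X i t ∂μ = 0) :
    ∫ ω : ι → Ω, ∑ i, X i (ω i) ∂(Measure.pi fun _ => μ) = 0 := by
  have hm : ∀ i, MemLp (fun ω : ι → Ω => X i (ω i)) 2 (Measure.pi fun _ => μ) := fun i =>
    (hX i).comp_measurePreserving (measurePreserving_eval _ i)
  rw [integral_finsetSum _ fun i _ => (hm i).integrable (by norm_num)]
  refine Finset.sum_eq_zero fun i _ => ?_
  rw [← h0 i]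
  exact integral_comp_eval (μ := fun _ : ι => μ) (i := i) (hX i).aestronglyMeasurable

theorem variance_pi_sum {X : ι → Ω → ℝ} (hX : ∀ i, MemLp (X i) 2 μ) :
    variance (fun ω : ι → Ω => ∑ i, X i (ω i)) (Measure.pi fun _ => μ) =
      ∑ i, variance (X i) μ := by
  rw [← variance_sum_pi hX]
  congr 1
  ext ω
  simp

end Moments

/-! ### Second moments of one random row and one random matrix. -/

section Rows

variable {P : Measure ℝ} {σ : ℝ} {d m : ℕ}

/-- The law of a random row. -/
abbrev rowLaw (P : Measure ℝ) (d : ℕ) : Measure (Fin d → ℝ) := Measure.pi fun _ => P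

/-- The law of a random matrix. -/
abbrev matLaw (P : Measure ℝ) (m d : ℕ) : Measure (Fin m → Fin d → ℝ) :=
  Measure.pi fun _ => rowLaw P d

theorem IsInitLaw.memLp_row (hP : IsInitLaw P σ) (u : Fin d → ℝ) :
    MemLp (fun w : Fin d → ℝ => w ⬝ᵥ u) 2 (rowLaw P d) := by
  have := hP.isProbabilityMeasure
  exact memLp_pi_sum P (X := fun i t => t * u i) fun i => hP.memLp_two.mul_const (u i)

theorem IsInitLaw.integral_row (hP : IsInitLaw P σ) (u : Fin d → ℝ) :
    ∫ w, w ⬝ᵥ u ∂(rowLaw P d) = 0 := by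
  have := hP.isProbabilityMeasure
  refine integral_pi_sum_eq_zero P (X := fun i t => t * u i)
    (fun i => hP.memLp_two.mul_const (u i)) fun i => ?_
  rw [integral_mul_const, hP.integral_eq_zero, zero_mul]

theorem IsInitLaw.variance_row (hP : IsInitLaw P σ) (u : Fin d → ℝ) :
    variance (fun w => w ⬝ᵥ u) (rowLaw P d) = σ ^ 2 * sqSum u := by
  have := hP.isProbabilityMeasure
  refine (variance_pi_sum P (X := fun i t => t * u i)
    fun i => hP.memLp_two.mul_const (u i)).trans ?_
  rw [sqSum, Finset.mul_sum]
  refine Finset.sum_congr rfl fun i _ => ?_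
  rw [variance_mul_const]
  exact congrArg (· * u i ^ 2) hP.variance_eq

theorem IsInitLaw.lintegral_row_sq (hP : IsInitLaw P σ) (u : Fin d → ℝ) :
    ∫⁻ w, ENNReal.ofReal ((w ⬝ᵥ u) ^ 2) ∂(rowLaw P d) = ENNReal.ofReal (σ ^ 2 * sqSum u) := by
  rw [lintegral_ofReal_sq_eq_variance (hP.memLp_row u) (hP.integral_row u), hP.variance_row]

theorem Activation.measurable_gate (act : Activation) : Measurable act.gate := by
  cases act with
  | linear => exact measurable_const
  | relu => exact Measurable.ite measurableSet_Ioi measurable_const measurable_const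

theorem Activation.measurable_apply (act : Activation) : Measurable act.apply := by
  cases act with
  | linear => exact measurable_id
  | relu => exact measurable_id.max measurable_const

theorem Activation.gate_sq_le_one (act : Activation) (t : ℝ) : act.gate t ^ 2 ≤ 1 := by
  cases act with
  | linear => simp [gate]
  | relu => by_cases h : 0 < t <;> simp [gate, h]

theorem measurable_dotProduct_right (u : Fin d → ℝ) : Measurable fun w : Fin d → ℝ => w ⬝ᵥ u := by
  unfold dotProduct
  fun_prop

theorem measurable_dotProduct_left (u : Fin d → ℝ) : Measurable fun w : Fin d → ℝ => u ⬝ᵥ w := by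
  unfold dotProduct
  fun_prop

/-- A gated unit passes at most the fraction `p` of the second moment. -/
theorem IsInitLaw.lintegral_gate_row_sq_le (hP : IsInitLaw P σ) (act : Activation)
    (u v : Fin d → ℝ) :
    ∫⁻ w, ENNReal.ofReal (act.gate (w ⬝ᵥ v) ^ 2 * (w ⬝ᵥ u) ^ 2) ∂(rowLaw P d) ≤
      ENNReal.ofReal (act.p * σ ^ 2 * sqSum u) := by
  have := hP.isProbabilityMeasure
  cases act with
  | linear => simp [Activation.gate, Activation.p, hP.lintegral_row_sq]
  | relu =>
    have hmp : MeasurePreserving (fun (w : Fin d → ℝ) i => -w i) (rowLaw P d) (rowLaw P d) :=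
      measurePreserving_pi _ _ fun _ => ⟨measurable_neg, hP.symmetric⟩
    have hg := Activation.relu.measurable_gate
    have hu := measurable_dotProduct_right u
    have hv := measurable_dotProduct_right v
    have hf : Measurable fun w : Fin d → ℝ =>
        ENNReal.ofReal (Activation.relu.gate (w ⬝ᵥ v) ^ 2 * (w ⬝ᵥ u) ^ 2) := by fun_prop
    set I := ∫⁻ w, ENNReal.ofReal (Activation.relu.gate (w ⬝ᵥ v) ^ 2 * (w ⬝ᵥ u) ^ 2)
      ∂(rowLaw P d) with hI
    have h2 : I = ∫⁻ w, ENNReal.ofReal (Activation.relu.gate (-(w ⬝ᵥ v)) ^ 2 * (w ⬝ᵥ u) ^ 2)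
        ∂(rowLaw P d) := by
      rw [hI, ← hmp.lintegral_comp hf]
      congr 1
      ext w
      have e : (fun i => -w i) = -w := rfl
      rw [e, neg_dotProduct, neg_dotProduct, neg_sq (w ⬝ᵥ u)]
    -- The gate and its mirror image add up to at most one. On the hyperplane `w ⬝ᵥ v = 0` both are
    -- off, so only an inequality results.
    have h3 : I * 2 ≤ ENNReal.ofReal (σ ^ 2 * sqSum u) := by
      rw [← hP.lintegral_row_sq, mul_two]
      nth_rewrite 2 [h2]
      rw [hI, ← lintegral_add_left hf]
      refine lintegral_mono fun w => ?_
      rw [← ENNReal.ofReal_add (by positivity) (by positivity), ← add_mul]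
      refine ENNReal.ofReal_le_ofReal (mul_le_of_le_one_left (sq_nonneg _) ?_)
      rcases lt_trichotomy (w ⬝ᵥ v) 0 with h | h | h
      · simp [Activation.gate, h, not_lt.mpr h.le]
      · simp [Activation.gate, h]
      · simp [Activation.gate, h, not_lt.mpr h.le]
    have h4 : Activation.relu.p * σ ^ 2 * sqSum u = σ ^ 2 * sqSum u / 2 := by
      simp only [Activation.p]; ring
    rw [h4, ENNReal.ofReal_div_of_pos two_pos]
    simpa using (ENNReal.le_div_iff_mul_le (by simp) (by simp)).2 h3

theorem lintegral_matLaw_row [IsProbabilityMeasure P] {f : (Fin d → ℝ) → ℝ≥0∞} (hf : Measurable f)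
    (i : Fin m) : ∫⁻ M, f (M i) ∂(matLaw P m d) = ∫⁻ w, f w ∂(rowLaw P d) :=
  (measurePreserving_eval (fun _ : Fin m => rowLaw P d) i).lintegral_comp hf

theorem IsInitLaw.lintegral_gated_mulVec_le (hP : IsInitLaw P σ) (act : Activation)
    (u v : Fin d → ℝ) :
    ∫⁻ M, ENNReal.ofReal (∑ i, act.gate ((Matrix.of M *ᵥ v) i) ^ 2 * (Matrix.of M *ᵥ u) i ^ 2)
      ∂(matLaw P m d) ≤ ENNReal.ofReal (act.p * m * σ ^ 2 * sqSum u) := by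
  have := hP.isProbabilityMeasure
  have hg := act.measurable_gate
  have hu := measurable_dotProduct_right u
  have hv := measurable_dotProduct_right v
  have hf : Measurable fun w : Fin d → ℝ =>
      ENNReal.ofReal (act.gate (w ⬝ᵥ v) ^ 2 * (w ⬝ᵥ u) ^ 2) := by fun_prop
  calc _ = ∑ i : Fin m, ∫⁻ M, ENNReal.ofReal (act.gate (M i ⬝ᵥ v) ^ 2 * (M i ⬝ᵥ u) ^ 2)
          ∂(matLaw P m d) := by
        rw [← lintegral_finsetSum]
        · congr 1
          ext M
          rw [ENNReal.ofReal_sum_of_nonneg fun _ _ => by positivity]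
          rfl
        · exact fun i _ => hf.comp (measurable_pi_apply i)
    _ ≤ ∑ i : Fin m, ENNReal.ofReal (act.p * σ ^ 2 * sqSum u) := by
        refine Finset.sum_le_sum fun i _ => ?_
        rw [lintegral_matLaw_row hf i]
        exact hP.lintegral_gate_row_sq_le act u v
    _ = _ := by
        rw [Finset.sum_const, Finset.card_univ, Fintype.card_fin, nsmul_eq_mul,
          ← ENNReal.ofReal_natCast, ← ENNReal.ofReal_mul (Nat.cast_nonneg _)]
        congr 1; ring

theorem IsInitLaw.lintegral_mulVec_le (hP : IsInitLaw P σ) (u : Fin d → ℝ) :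
    ∫⁻ M, ENNReal.ofReal (sqSum (Matrix.of M *ᵥ u)) ∂(matLaw P m d) ≤
      ENNReal.ofReal (m * σ ^ 2 * sqSum u) := by
  have := hP.lintegral_gated_mulVec_le (m := m) Activation.linear u u
  simpa [Activation.gate, Activation.p, sqSum] using this

theorem measurable_mulVec_apply {m d : ℕ} (u : Fin d → ℝ) (i : Fin m) :
    Measurable fun M : Fin m → Fin d → ℝ => (Matrix.of M *ᵥ u) i :=
  (measurable_dotProduct_right u).comp (measurable_pi_apply i)

/-- The vector bound is summed over the columns of `N`; this handles a random output matrix. -/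
theorem IsInitLaw.lintegral_frobSq_mul_le (hP : IsInitLaw P σ) {q : ℕ}
    (N : Matrix (Fin d) (Fin q) ℝ) :
    ∫⁻ M, ENNReal.ofReal (frobSq (Matrix.of M * N)) ∂(matLaw P m d) ≤
      ENNReal.ofReal (m * σ ^ 2 * frobSq N) := by
  have := hP.isProbabilityMeasure
  rw [frobSq_eq_sum_col, Finset.mul_sum,
    ENNReal.ofReal_sum_of_nonneg fun j _ => mul_nonneg (by positivity) (sqSum_nonneg _)]
  calc _ = ∑ j, ∫⁻ M, ENNReal.ofReal (sqSum (Matrix.of M *ᵥ fun i => N i j)) ∂(matLaw P m d) := by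
        rw [← lintegral_finsetSum]
        · congr 1
          ext M
          rw [frobSq_eq_sum_col, ENNReal.ofReal_sum_of_nonneg fun _ _ => sqSum_nonneg _]
          rfl
        · intro j _
          have := measurable_mulVec_apply (m := m) fun i => N i j
          unfold sqSum
          fun_prop
    _ ≤ _ := Finset.sum_le_sum fun j _ => hP.lintegral_mulVec_le _

/-- A random layer between fixed matrices: no gates, so that the entries are uncorrelated. -/
theorem IsInitLaw.lintegral_mulVec_mulVec (hP : IsInitLaw P σ) {q : ℕ}
    (B : Matrix (Fin q) (Fin m) ℝ) (u : Fin d → ℝ) :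
    ∫⁻ M, ENNReal.ofReal (sqSum (B *ᵥ (Matrix.of M *ᵥ u))) ∂(matLaw P m d) =
      ENNReal.ofReal (σ ^ 2 * frobSq B * sqSum u) := by
  have := hP.isProbabilityMeasure
  have hmem : ∀ o i, MemLp (fun w : Fin d → ℝ => B o i * (w ⬝ᵥ u)) 2 (rowLaw P d) := fun o i =>
    (hP.memLp_row u).const_mul (B o i)
  -- For each output, independent centred rows are summed with weights `B o i`; the cross terms
  -- vanish.
  have key : ∀ o, ∫⁻ M, ENNReal.ofReal ((B *ᵥ (Matrix.of M *ᵥ u)) o ^ 2) ∂(matLaw P m d) =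
      ENNReal.ofReal (σ ^ 2 * (∑ i, B o i ^ 2) * sqSum u) := by
    intro o
    have h1 := lintegral_ofReal_sq_eq_variance (memLp_pi_sum (rowLaw P d) (hmem o))
      (integral_pi_sum_eq_zero (rowLaw P d) (hmem o) fun i => by
        rw [integral_const_mul, hP.integral_row, mul_zero])
    rw [variance_pi_sum (rowLaw P d) (hmem o)] at h1
    refine Eq.trans h1 ?_
    simp only [variance_const_mul, hP.variance_row]
    rw [← Finset.sum_mul]
    congr 1; ring
  have hB : σ ^ 2 * frobSq B * sqSum u = ∑ o, σ ^ 2 * (∑ i, B o i ^ 2) * sqSum u := by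
    rw [← Finset.sum_mul, ← Finset.mul_sum]
    rfl
  have hnn : ∀ o ∈ Finset.univ, 0 ≤ σ ^ 2 * (∑ i, B o i ^ 2) * sqSum u := fun o _ =>
    mul_nonneg (mul_nonneg (sq_nonneg σ) (Finset.sum_nonneg fun _ _ => sq_nonneg _)) (sqSum_nonneg u)
  rw [hB, ENNReal.ofReal_sum_of_nonneg hnn]
  simp only [← key]
  rw [← lintegral_finsetSum]
  · congr 1
    ext M
    rw [sqSum, ENNReal.ofReal_sum_of_nonneg fun _ _ => sq_nonneg _]
  · intro o _
    have := measurable_mulVec_apply (m := m) u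
    have : Measurable fun M : Fin m → Fin d → ℝ => (B *ᵥ (Matrix.of M *ᵥ u)) o :=
      (measurable_dotProduct_left (B o)).comp (measurable_pi_lambda _ this)
    fun_prop

end Rows

/-! ### Measurability of the gates, the chains and the derivatives of the output. -/

section Measurability

variable {Ω : Type*} [MeasurableSpace Ω] {L d dIn dOut n : ℕ}

theorem preact_succ (act : Activation) (W : Weights L d) (z : Fin d → ℝ) (b : ℕ) :
    preact act W z (b + 1) = layer W b *ᵥ fun i => act.apply (preact act W z b i) := by
  by_cases h : b < L <;> simp [preact, layer, h]

theorem measurable_layer {W : Ω → Weights L d} (hW : Measurable W) (b : ℕ) (i j : Fin d) :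
    Measurable fun θ => layer (W θ) b i j := by
  by_cases h : b < L
  · simp only [layer, h, dite_true, Matrix.of_apply]
    fun_prop
  · simp only [layer, h, dite_false]
    exact measurable_const

theorem measurable_mulVec {m k : ℕ} {M : Ω → Matrix (Fin m) (Fin k) ℝ} {v : Ω → Fin k → ℝ}
    (hM : ∀ i j, Measurable fun θ => M θ i j) (hv : ∀ j, Measurable fun θ => v θ j) (i : Fin m) :
    Measurable fun θ => (M θ *ᵥ v θ) i := by
  simp only [Matrix.mulVec, dotProduct]
  fun_prop

theorem measurable_mul {m k q : ℕ} {M : Ω → Matrix (Fin m) (Fin k) ℝ}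
    {N : Ω → Matrix (Fin k) (Fin q) ℝ}
    (hM : ∀ i j, Measurable fun θ => M θ i j) (hN : ∀ i j, Measurable fun θ => N θ i j)
    (i : Fin m) (j : Fin q) : Measurable fun θ => (M θ * N θ) i j := by
  simp only [Matrix.mul_apply]
  fun_prop

theorem measurable_frobSq {m k : ℕ} {M : Ω → Matrix (Fin m) (Fin k) ℝ}
    (hM : ∀ i j, Measurable fun θ => M θ i j) : Measurable fun θ => frobSq (M θ) := by
  unfold frobSq
  fun_prop

theorem measurable_sqSum {k : ℕ} {v : Ω → Fin k → ℝ} (hv : ∀ j, Measurable fun θ => v θ j) :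
    Measurable fun θ => sqSum (v θ) := by
  unfold sqSum
  fun_prop

theorem measurable_preact (act : Activation) {W : Ω → Weights L d} (hW : Measurable W)
    {z : Ω → Fin d → ℝ} (hz : ∀ i, Measurable fun θ => z θ i) (b : ℕ) (i : Fin d) :
    Measurable fun θ => preact act (W θ) (z θ) b i := by
  induction b generalizing i with
  | zero => exact hz i
  | succ b ih =>
    simp only [preact_succ]
    exact measurable_mulVec (measurable_layer hW b) (fun j => act.measurable_apply.comp (ih j)) i

theorem measurable_gates (act : Activation) {W : Ω → Weights L d} (hW : Measurable W)
    {z : Ω → Fin d → ℝ} (hz : ∀ i, Measurable fun θ => z θ i) (b : ℕ) (i : Fin d) :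
    Measurable fun θ => gates act (W θ) (z θ) b i :=
  act.measurable_gate.comp (measurable_preact act hW hz b i)

theorem measurable_chain (act : Activation) {W : Ω → Weights L d} (hW : Measurable W)
    {z : Ω → Fin d → ℝ} (hz : ∀ i, Measurable fun θ => z θ i) (a b : ℕ) (i j : Fin d) :
    Measurable fun θ => chain (gates act (W θ) (z θ)) (W θ) a b i j := by
  have hdiag : ∀ (b : ℕ) (i j : Fin d),
      Measurable fun θ => Matrix.diagonal (gates act (W θ) (z θ) b) i j := by
    intro b i j
    by_cases h : i = j
    · subst h
      simpa using measurable_gates act hW hz b i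
    · simp [h]
  induction b generalizing i j with
  | zero => exact hdiag 0 i j
  | succ b ih =>
    by_cases hab : a ≤ b
    · simp only [chain, if_pos hab]
      exact measurable_mul (hdiag _) (measurable_mul (measurable_layer hW b) ih) i j
    · simp only [chain, if_neg hab]
      exact hdiag _ i j

variable (act : Activation) {W : Ω → Weights L d} (hW : Measurable W)
    {z : Ω → Fin d → ℝ} (hz : ∀ i, Measurable fun θ => z θ i)
    {B : Ω → Matrix (Fin dOut) (Fin d) ℝ} (hB : ∀ o i, Measurable fun θ => B θ o i)

theorem measurable_sqSum_chain_mulVec (act : Activation) {W : Ω → Weights L d} (hW : Measurable W)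
    {z : Ω → Fin d → ℝ} (hz : ∀ i, Measurable fun θ => z θ i) {u : Ω → Fin d → ℝ}
    (hu : ∀ i, Measurable fun θ => u θ i) (a b : ℕ) :
    Measurable fun θ => sqSum (chain (gates act (W θ) (z θ)) (W θ) a b *ᵥ u θ) :=
  measurable_sqSum (measurable_mulVec (measurable_chain act hW hz a b) hu)

theorem measurable_frobSq_chain (act : Activation) {W : Ω → Weights L d} (hW : Measurable W)
    {z : Ω → Fin d → ℝ} (hz : ∀ i, Measurable fun θ => z θ i) (a b : ℕ) :
    Measurable fun θ => frobSq (chain (gates act (W θ) (z θ)) (W θ) a b) :=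
  measurable_frobSq (measurable_chain act hW hz a b)

include hW hz hB

theorem measurable_frobSq_mul_chain (a b : ℕ) :
    Measurable fun θ => frobSq (B θ * chain (gates act (W θ) (z θ)) (W θ) a b) :=
  measurable_frobSq (measurable_mul hB (measurable_chain act hW hz a b))

theorem measurable_ampSq (k : ℕ) : Measurable fun θ => ampSq act (B θ) (z θ) (W θ) k :=
  (measurable_frobSq_mul_chain act hW hz hB _ _).mul (measurable_sqSum_chain_mulVec act hW hz hz _ _)

theorem measurable_ampSq₂ (k l : ℕ) : Measurable fun θ => ampSq₂ act (B θ) (z θ) (W θ) k l :=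
  (measurable_frobSq_mul_chain act hW hz hB _ _).mul
    ((measurable_frobSq_chain act hW hz _ _).mul (measurable_sqSum_chain_mulVec act hW hz hz _ _))

theorem measurable_netOut (o : Fin dOut) :
    Measurable fun θ => netOut act (B θ) (z θ) (W θ) o :=
  measurable_mulVec hB (measurable_mulVec (measurable_chain act hW hz 0 L) hz) o

theorem measurable_outDeriv (k : ℕ) (i j : Fin d) (o : Fin dOut) :
    Measurable fun θ => outDeriv (B θ) (gates act (W θ) (z θ)) (z θ) (W θ) k i j o :=
  (measurable_mul hB (measurable_chain act hW hz _ _) o i).mul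
    (measurable_mulVec (measurable_chain act hW hz _ _) hz j)

theorem measurable_outDeriv₂ (k l : ℕ) (i j i' j' : Fin d) (o : Fin dOut) :
    Measurable fun θ => outDeriv₂ (B θ) (gates act (W θ) (z θ)) (z θ) (W θ) k l i j i' j' o :=
  (measurable_mul hB (measurable_chain act hW hz _ _) o i').mul
    ((measurable_chain act hW hz _ _ j' i).mul
      (measurable_mulVec (measurable_chain act hW hz _ _) hz j))

end Measurability

/-! ### Measurability of the gradient and Hessian norms. -/

section MeasurableNorms

variable {Ω : Type*} [MeasurableSpace Ω] {L d dIn dOut n : ℕ} (act : Activation)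
  {W : Ω → Weights L d} (hW : Measurable W)
  {A : Ω → Matrix (Fin d) (Fin dIn) ℝ} (hA : ∀ i j, Measurable fun θ => A θ i j)
  {B : Ω → Matrix (Fin dOut) (Fin d) ℝ} (hB : ∀ o i, Measurable fun θ => B θ o i)
  (x : Fin n → Fin dIn → ℝ) (y : Fin n → Fin dOut → ℝ)

include hW hA hB

/-- The function being differentiated itself varies with `θ`, so measurability is read off the
closed formula for the block. -/
theorem measurable_gradNorm (k : Fin L) :
    Measurable fun θ => gradNorm act (A θ) (B θ) x y (W θ) k := by
  have hz : ∀ s i, Measurable fun θ => (A θ *ᵥ x s) i := fun s =>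
    measurable_mulVec hA fun _ => measurable_const
  have h1 := fun s => measurable_netOut act hW (hz s) hB
  have h2 := fun s i j o => measurable_outDeriv act hW (hz s) hB k i j o
  simp only [gradNorm, frobNorm, gradBlock_eq, Matrix.smul_apply, Matrix.sum_apply,
    Matrix.of_apply, Pi.sub_apply]
  fun_prop

theorem measurable_hessNorm (k l : Fin L) :
    Measurable fun θ => hessNorm act (A θ) (B θ) x y (W θ) k l := by
  wlog hkl : k ≤ l generalizing k l
  · simp only [hessNorm_comm act _ _ x y _ k l]
    exact this l k (le_of_not_ge hkl)
  have hz : ∀ s i, Measurable fun θ => (A θ *ᵥ x s) i := fun s =>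
    measurable_mulVec hA fun _ => measurable_const
  have h1 := fun s => measurable_netOut act hW (hz s) hB
  have h2 := fun s i j o => measurable_outDeriv act hW (hz s) hB k i j o
  have h3 := fun s i j o => measurable_outDeriv act hW (hz s) hB l i j o
  have h4 := fun s i j i' j' o => measurable_outDeriv₂ act hW (hz s) hB k l i j i' j' o
  simp only [hessNorm, frobNorm]
  rcases eq_or_lt_of_le hkl with rfl | hlt
  · simp only [hessBlock_self_eq, Matrix.smul_apply, Matrix.sum_apply, Matrix.of_apply]
    fun_prop
  · simp only [hessBlock_eq_of_lt _ _ _ _ _ _ hlt, Matrix.smul_apply, Matrix.sum_apply,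
      Matrix.add_apply, Matrix.of_apply, Pi.sub_apply]
    fun_prop

end MeasurableNorms

/-! ### Expectations of gated products, one layer at a time. -/

section ChainExpectation

variable {L d dIn dOut n : ℕ} {P : Measure ℝ} {σ : ℝ}

theorem isProbabilityMeasure_initLaw [IsProbabilityMeasure P] :
    IsProbabilityMeasure (initLaw P L d) := by
  unfold initLaw
  infer_instance

/-- The function depends only on the weight matrices with index below `a`. -/
def DependsBelow {β : Type*} (a : ℕ) (g : Weights L d → β) : Prop :=
  ∀ W V : Weights L d, (∀ j < a, layer W j = layer V j) → g W = g V

theorem DependsBelow.mono {β : Type*} {a b : ℕ} {g : Weights L d → β} (h : DependsBelow a g)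
    (hab : a ≤ b) : DependsBelow b g := fun W V hWV => h W V fun j hj => hWV j (hj.trans_le hab)

theorem layer_update_of_ne (W : Weights L d) (b : Fin L) (w : Fin d → Fin d → ℝ) {j : ℕ}
    (h : j ≠ b) : layer (Function.update W b w) j = layer W j := by
  by_cases hj : j < L
  · have : (⟨j, hj⟩ : Fin L) ≠ b := fun e => h (by rw [← e])
    simp [layer, hj, this]
  · simp [layer, hj]

theorem layer_update_self (W : Weights L d) (b : Fin L) (w : Fin d → Fin d → ℝ) :
    layer (Function.update W b w) b = Matrix.of w := by
  simp [layer]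

theorem DependsBelow.update {β : Type*} {a : ℕ} {g : Weights L d → β} (h : DependsBelow a g)
    (W : Weights L d) {b : Fin L} (hb : a ≤ b) (w : Fin d → Fin d → ℝ) :
    g (Function.update W b w) = g W :=
  h _ _ fun j hj => layer_update_of_ne W b w (by omega)

theorem dependsBelow_preact (act : Activation) (z : Fin d → ℝ) (b : ℕ) :
    DependsBelow b fun W : Weights L d => preact act W z b := by
  intro W V h
  induction b with
  | zero => rfl
  | succ b ih =>
    have := ih fun j hj => h j (by omega)
    simp only at this ⊢
    rw [preact_succ, preact_succ, h b (Nat.lt_succ_self b), this]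

/-- The gate of level `b` is read off a preactivation built from layers below `b`, so the top gate
brings no new dependence. -/
theorem dependsBelow_chain (act : Activation) (z : Fin d → ℝ) (a b : ℕ) :
    DependsBelow b fun W : Weights L d => chain (gates act W z) W a b := by
  have hg : ∀ b, DependsBelow b fun W : Weights L d => gates act W z b := by
    intro b W V h
    have := dependsBelow_preact act z b W V h
    simp only at this ⊢
    ext i
    simp only [gates, this]
  intro W V h
  induction b with
  | zero =>
    have := hg 0 W V h
    simp only [chain] at this ⊢
    rw [this]
  | succ b ih =>
    have h1 := hg (b + 1) W V h
    have h2 := ih fun j hj => h j (by omega)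
    simp only [chain] at h1 h2 ⊢
    rw [h1, h2, h b (Nat.lt_succ_self b)]

theorem sqSum_diagonal_gates_le (act : Activation) (W : Weights L d) (z u : Fin d → ℝ) (b : ℕ) :
    sqSum (Matrix.diagonal (gates act W z b) *ᵥ u) ≤ sqSum u := by
  refine Finset.sum_le_sum fun i _ => ?_
  rw [Matrix.mulVec_diagonal, mul_pow]
  exact mul_le_of_le_one_left (sq_nonneg _) (act.gate_sq_le_one _)

/-- Integrating out one layer. -/
theorem lintegral_layer_le [IsProbabilityMeasure P] (b : Fin L) {g H : Weights L d → ℝ≥0∞}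
    {Φ : Matrix (Fin d) (Fin d) ℝ → Weights L d → ℝ≥0∞} {K : ℝ≥0∞} (hg : Measurable g)
    (hH : Measurable H) (hΦ : Measurable fun W => Φ (layer W b) W)
    (hΦ' : ∀ W, Measurable fun w => Φ (Matrix.of w) W)
    (hgdep : DependsBelow b g) (hΦdep : ∀ M, DependsBelow b (Φ M))
    (hle : ∀ W, ∫⁻ w, Φ (Matrix.of w) W ∂(matLaw P d d) ≤ K * H W) :
    ∫⁻ W, g W * Φ (layer W b) W ∂(initLaw P L d) ≤ K * ∫⁻ W, g W * H W ∂(initLaw P L d) := by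
  have h1 : Measurable fun W => g W * Φ (layer W b) W := hg.mul hΦ
  have h2 : Measurable fun W => g W * H W := hg.mul hH
  rw [initLaw, lintegral_pi_update _ h1 b, ← lintegral_const_mul _ h2]
  refine lintegral_mono fun W => ?_
  -- Only the matrix argument of `Φ` feels the new layer; the rest is a constant factor of the inner
  -- integral.
  simp only [hgdep.update W le_rfl, (hΦdep _).update W le_rfl, layer_update_self]
  rw [lintegral_const_mul _ (hΦ' W), mul_left_comm]
  gcongr
  exact hle W

theorem lam_nonneg (act : Activation) (d : ℕ) (σ : ℝ) : 0 ≤ lam act d σ := by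
  cases act <;> simp only [lam, Activation.p] <;> positivity

/-- The propagated vector `c` and the gate-driving vector `v` are kept separate, because the chain
is later applied to basis vectors while the gates follow the actual input. -/
theorem IsInitLaw.lintegral_gated_layer_le (hP : IsInitLaw P σ) (act : Activation) (b : Fin L)
    {g : Weights L d → ℝ≥0∞} {c v : Weights L d → Fin d → ℝ} (hg : Measurable g)
    (hc : ∀ i, Measurable fun W => c W i) (hv : ∀ i, Measurable fun W => v W i)
    (hgdep : DependsBelow b g) (hcdep : DependsBelow b c) (hvdep : DependsBelow b v) :
    ∫⁻ W, g W * ENNReal.ofReal (∑ i, act.gate ((layer W b *ᵥ v W) i) ^ 2 *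
        (layer W b *ᵥ c W) i ^ 2) ∂(initLaw P L d) ≤
      ENNReal.ofReal (lam act d σ) *
        ∫⁻ W, g W * ENNReal.ofReal (sqSum (c W)) ∂(initLaw P L d) := by
  have := hP.isProbabilityMeasure
  have hgate := act.measurable_gate
  refine lintegral_layer_le b (Φ := fun M W => ENNReal.ofReal (∑ i, act.gate ((M *ᵥ v W) i) ^ 2 *
        (M *ᵥ c W) i ^ 2)) hg (measurable_sqSum hc).ennreal_ofReal ?_ ?_ hgdep ?_ ?_
  · have h1 := measurable_mulVec (measurable_layer (W := fun W => W) measurable_id b) hv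
    have h2 := measurable_mulVec (measurable_layer (W := fun W => W) measurable_id b) hc
    fun_prop
  · intro W
    have h1 := measurable_mulVec_apply (m := d) (v W)
    have h2 := measurable_mulVec_apply (m := d) (c W)
    fun_prop
  · intro M W V h
    simp only [hcdep W V h, hvdep W V h]
  · intro W
    rw [← ENNReal.ofReal_mul (lam_nonneg act d σ)]
    exact hP.lintegral_gated_mulVec_le act _ _

theorem IsInitLaw.lintegral_mulVec_layer_le (hP : IsInitLaw P σ) (b : Fin L)
    (B : Matrix (Fin dOut) (Fin d) ℝ)
    {g : Weights L d → ℝ≥0∞} {c : Weights L d → Fin d → ℝ} (hg : Measurable g)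
    (hc : ∀ i, Measurable fun W => c W i)
    (hgdep : DependsBelow b g) (hcdep : DependsBelow b c) :
    ∫⁻ W, g W * ENNReal.ofReal (sqSum (B *ᵥ (layer W b *ᵥ c W))) ∂(initLaw P L d) ≤
      ENNReal.ofReal (σ ^ 2 * frobSq B) *
        ∫⁻ W, g W * ENNReal.ofReal (sqSum (c W)) ∂(initLaw P L d) := by
  have := hP.isProbabilityMeasure
  refine lintegral_layer_le b (Φ := fun M W => ENNReal.ofReal (sqSum (B *ᵥ (M *ᵥ c W)))) hg
    (measurable_sqSum hc).ennreal_ofReal ?_ ?_ hgdep ?_ ?_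
  · exact (measurable_sqSum (measurable_mulVec (M := fun _ => B) (fun _ _ => measurable_const)
      (measurable_mulVec (measurable_layer (W := fun W => W) measurable_id b) hc))).ennreal_ofReal
  · exact fun W => (measurable_sqSum (measurable_mulVec (M := fun _ => B)
      (fun _ _ => measurable_const) (measurable_mulVec_apply (c W)))).ennreal_ofReal
  · intro M W V h
    simp only [hcdep W V h]
  · intro W
    rw [← ENNReal.ofReal_mul (mul_nonneg (sq_nonneg σ) (frobSq_nonneg B))]
    exact (hP.lintegral_mulVec_mulVec B _).le

theorem measurable_chain_weights (act : Activation) (z : Fin d → ℝ) (a b : ℕ) (i j : Fin d) :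
    Measurable fun W : Weights L d => chain (gates act W z) W a b i j :=
  measurable_chain act (W := fun W => W) (z := fun _ => z) measurable_id
    (fun _ => measurable_const) a b i j

theorem measurable_chain_weights_mulVec (act : Activation) (z u : Fin d → ℝ) (a b : ℕ)
    (i : Fin d) : Measurable fun W : Weights L d => (chain (gates act W z) W a b *ᵥ u) i :=
  measurable_mulVec (v := fun _ => u) (measurable_chain_weights act z a b)
    (fun _ => measurable_const) i

theorem measurable_sqSum_chain_weights (act : Activation) (z u : Fin d → ℝ) (a b : ℕ) :
    Measurable fun W : Weights L d =>
      ENNReal.ofReal (sqSum (chain (gates act W z) W a b *ᵥ u)) :=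
  (measurable_sqSum (measurable_chain_weights_mulVec act z u a b)).ennreal_ofReal

/-- Induction on the top layer, each step costing `λ`. The weight `g` carries whatever factors live
below layer `a`, so that products of chains can be treated successively. -/
theorem IsInitLaw.lintegral_chain_mulVec_le (hP : IsInitLaw P σ) (act : Activation)
    {g : Weights L d → ℝ≥0∞} (hg : Measurable g) {a : ℕ} (hdep : DependsBelow a g)
    (z u : Fin d → ℝ) {b : ℕ} (hab : a ≤ b) (hbL : b ≤ L) :
    ∫⁻ W, g W * ENNReal.ofReal (sqSum (chain (gates act W z) W a b *ᵥ u)) ∂(initLaw P L d) ≤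
      ENNReal.ofReal (lam act d σ ^ (b - a) * sqSum u) * ∫⁻ W, g W ∂(initLaw P L d) := by
  induction b, hab using Nat.le_induction with
  | base =>
    rw [← lintegral_const_mul _ hg]
    refine lintegral_mono fun W => ?_
    rw [mul_comm, chain_self, Nat.sub_self, pow_zero, one_mul]
    gcongr
    exact sqSum_diagonal_gates_le act W z u a
  | succ b hab ih =>
    have hb : b < L := hbL
    have h1 : ∀ W : Weights L d, sqSum (chain (gates act W z) W a (b + 1) *ᵥ u) =
        ∑ i, act.gate ((layer W b *ᵥ fun i => act.apply (preact act W z b i)) i) ^ 2 *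
          (layer W b *ᵥ (chain (gates act W z) W a b *ᵥ u)) i ^ 2 := by
      intro W
      rw [chain_succ _ _ hab, ← Matrix.mulVec_mulVec, ← Matrix.mulVec_mulVec]
      refine Finset.sum_congr rfl fun i _ => ?_
      rw [Matrix.mulVec_diagonal, mul_pow, gates, preact_succ]
    simp only [h1]
    refine (hP.lintegral_gated_layer_le act ⟨b, hb⟩ hg
      (measurable_chain_weights_mulVec act z u a b) (fun i => act.measurable_apply.comp
        (measurable_preact act (W := fun W => W) (z := fun _ => z) measurable_id
          (fun _ => measurable_const) b i)) (hdep.mono hab)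
      ?_ ?_).trans ?_
    · intro W V h
      have := dependsBelow_chain act z a b W V h
      simp only at this ⊢
      rw [this]
    · intro W V h
      exact funext fun i => congrArg act.apply (congrFun (dependsBelow_preact act z b W V h) i)
    · refine (mul_le_mul_right (ih hb.le) _).trans_eq ?_
      rw [← mul_assoc, ← ENNReal.ofReal_mul (lam_nonneg act d σ), ← mul_assoc, ← pow_succ',
        Nat.sub_add_comm hab]

theorem frobSq_eq_sum_mulVec {ι : Type*} [Fintype ι] (M : Matrix ι (Fin d) ℝ) :
    frobSq M = ∑ j, sqSum (M *ᵥ Pi.single j 1) := by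
  rw [frobSq_eq_sum_col]
  simp only [Matrix.mulVec_single_one]
  rfl

theorem sqSum_single (j : Fin d) : sqSum (Pi.single j 1 : Fin d → ℝ) = 1 := by
  simp [sqSum, Pi.single_apply]

/-- The `d` columns are images of unit vectors; each obeys the vector bound. -/
theorem IsInitLaw.lintegral_frobSq_chain_le (hP : IsInitLaw P σ) (act : Activation)
    {g : Weights L d → ℝ≥0∞} (hg : Measurable g) {a : ℕ} (hdep : DependsBelow a g)
    (z : Fin d → ℝ) {b : ℕ} (hab : a ≤ b) (hbL : b ≤ L) :
    ∫⁻ W, g W * ENNReal.ofReal (frobSq (chain (gates act W z) W a b)) ∂(initLaw P L d) ≤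
      ENNReal.ofReal (d * lam act d σ ^ (b - a)) * ∫⁻ W, g W ∂(initLaw P L d) := by
  have hmeas : ∀ j, Measurable fun W : Weights L d =>
      ENNReal.ofReal (sqSum (chain (gates act W z) W a b *ᵥ Pi.single j 1)) := fun j =>
    measurable_sqSum_chain_weights act z _ a b
  have hmeas' : ∀ j ∈ Finset.univ, Measurable fun W : Weights L d =>
      g W * ENNReal.ofReal (sqSum (chain (gates act W z) W a b *ᵥ Pi.single j 1)) := fun j _ =>
    hg.mul (hmeas j)
  simp only [frobSq_eq_sum_mulVec]
  calc _ = ∑ j, ∫⁻ W, g W * ENNReal.ofReal (sqSum (chain (gates act W z) W a b *ᵥ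
          Pi.single j 1)) ∂(initLaw P L d) := by
        rw [← lintegral_finsetSum _ hmeas']
        congr 1
        ext W
        rw [ENNReal.ofReal_sum_of_nonneg fun _ _ => sqSum_nonneg _, Finset.mul_sum]
    _ ≤ ∑ j : Fin d, ENNReal.ofReal (lam act d σ ^ (b - a)) * ∫⁻ W, g W ∂(initLaw P L d) := by
        refine Finset.sum_le_sum fun j _ => ?_
        have := hP.lintegral_chain_mulVec_le act hg hdep z (Pi.single j 1) hab hbL
        rwa [sqSum_single, mul_one] at this
    _ = _ := by
        rw [Finset.sum_const, Finset.card_univ, Fintype.card_fin, nsmul_eq_mul, ← mul_assoc,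
          ENNReal.ofReal_mul (Nat.cast_nonneg d), ENNReal.ofReal_natCast]

end ChainExpectation

/-! ### Second moments of the output and its derivatives for fixed `A`, `B`. -/

section ChainProducts

variable {L d dIn dOut n : ℕ} {P : Measure ℝ} {σ : ℝ}

theorem DependsBelow.comp {β γ : Type*} {a : ℕ} {g : Weights L d → β} (h : DependsBelow a g)
    (f : β → γ) : DependsBelow a fun W => f (g W) := fun W V hWV => congrArg f (h W V hWV)

theorem measurable_frobSq_chain_weights (act : Activation)
    (z : Fin d → ℝ) (a b : ℕ) : Measurable fun W : Weights L d =>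
      ENNReal.ofReal (frobSq (chain (gates act W z) W a b)) :=
  (measurable_frobSq (measurable_chain_weights act z a b)).ennreal_ofReal

/-- In linear networks a fixed output matrix costs no factor of the width. -/
theorem IsInitLaw.lintegral_frobSq_mul_chain_linear_le (hP : IsInitLaw P σ)
    (B : Matrix (Fin dOut) (Fin d) ℝ)
    {g : Weights L d → ℝ≥0∞} (hg : Measurable g) {a : ℕ} (hdep : DependsBelow a g)
    (z : Fin d → ℝ) (haL : a ≤ L) :
    ∫⁻ W, g W * ENNReal.ofReal (frobSq (B * chain (gates .linear W z) W a L)) ∂(initLaw P L d) ≤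
      ENNReal.ofReal (frobSq B * lam .linear d σ ^ (L - a)) * ∫⁻ W, g W ∂(initLaw P L d) := by
  have hdiag : ∀ (W : Weights L d) b, Matrix.diagonal (gates .linear W z b) = 1 := by
    intro W b
    rw [← Matrix.diagonal_one]
    rfl
  rcases eq_or_lt_of_le haL with rfl | hlt
  · simp only [chain_self, hdiag, Matrix.mul_one, Nat.sub_self, pow_zero]
    rw [lintegral_mul_const _ hg, mul_comm, mul_one]
  · obtain ⟨b, rfl⟩ : ∃ b, L = b + 1 := ⟨L - 1, by omega⟩
    have hab : a ≤ b := by omega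
    have hmeas : ∀ j ∈ Finset.univ, Measurable fun W : Weights (b + 1) d =>
        g W * ENNReal.ofReal (sqSum ((B * chain (gates .linear W z) W a (b + 1)) *ᵥ
          Pi.single j 1)) := fun j _ =>
      hg.mul (measurable_sqSum (measurable_mulVec (v := fun _ => Pi.single j 1)
        (measurable_mul (M := fun _ => B) (fun _ _ => measurable_const)
          (measurable_chain_weights _ z a _)) fun _ => measurable_const)).ennreal_ofReal
    have key : ∀ j : Fin d, ∫⁻ W, g W * ENNReal.ofReal (sqSum ((B *
        chain (gates .linear W z) W a (b + 1)) *ᵥ Pi.single j 1)) ∂(initLaw P (b + 1) d) ≤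
        ENNReal.ofReal (σ ^ 2 * frobSq B * lam .linear d σ ^ (b - a)) *
          ∫⁻ W, g W ∂(initLaw P (b + 1) d) := by
      intro j
      simp only [chain_succ _ _ hab, hdiag, Matrix.one_mul, ← Matrix.mulVec_mulVec]
      refine (hP.lintegral_mulVec_layer_le (Fin.last b) B hg
        (measurable_chain_weights_mulVec _ z _ a b) (hdep.mono hab) ?_).trans ?_
      · exact (dependsBelow_chain .linear z a b).comp (· *ᵥ Pi.single j 1)
      · rw [ENNReal.ofReal_mul (mul_nonneg (sq_nonneg σ) (frobSq_nonneg B)), mul_assoc]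
        gcongr
        have := hP.lintegral_chain_mulVec_le .linear hg hdep z (Pi.single j 1) hab (Nat.le_succ b)
        rwa [sqSum_single, mul_one] at this
    calc _ = ∑ j, ∫⁻ W, g W * ENNReal.ofReal (sqSum ((B * chain (gates .linear W z) W a (b + 1)) *ᵥ
          Pi.single j 1)) ∂(initLaw P (b + 1) d) := by
          rw [← lintegral_finsetSum _ hmeas]
          congr 1
          ext W
          rw [frobSq_eq_sum_mulVec, ENNReal.ofReal_sum_of_nonneg fun _ _ => sqSum_nonneg _,
            Finset.mul_sum]
      _ ≤ _ := Finset.sum_le_sum fun j _ => key j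
      -- The `d` basis vectors combine with the `σ ^ 2` of the last layer into one more factor `λ`,
      -- since `p = 1`.
      _ = _ := by
          rw [Finset.sum_const, Finset.card_univ, Fintype.card_fin, nsmul_eq_mul, ← mul_assoc,
            ← ENNReal.ofReal_natCast, ← ENNReal.ofReal_mul (Nat.cast_nonneg d),
            Nat.sub_add_comm hab, pow_succ]
          congr 2
          simp only [lam, Activation.p]
          ring

/-- Gated rows need not be centred, so for ReLU the cross terms under `B` may survive.
Submultiplicativity of the Frobenius norm is used instead, at the price of `d`. -/
theorem IsInitLaw.lintegral_frobSq_mul_chain_le (hP : IsInitLaw P σ) (act : Activation)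
    (B : Matrix (Fin dOut) (Fin d) ℝ)
    {g : Weights L d → ℝ≥0∞} (hg : Measurable g) {a : ℕ} (hdep : DependsBelow a g)
    (z : Fin d → ℝ) (haL : a ≤ L) :
    ∫⁻ W, g W * ENNReal.ofReal (frobSq (B * chain (gates act W z) W a L)) ∂(initLaw P L d) ≤
      ENNReal.ofReal (act.widthFactor d * frobSq B * lam act d σ ^ (L - a)) *
        ∫⁻ W, g W ∂(initLaw P L d) := by
  cases act with
  | linear =>
    simpa [Activation.widthFactor] using
      hP.lintegral_frobSq_mul_chain_linear_le B hg hdep z haL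
  | relu =>
    have hm : Measurable fun W : Weights L d =>
        g W * ENNReal.ofReal (frobSq (chain (gates .relu W z) W a L)) :=
      hg.mul (measurable_frobSq_chain_weights .relu z a L)
    calc _ ≤ ∫⁻ W, ENNReal.ofReal (frobSq B) *
          (g W * ENNReal.ofReal (frobSq (chain (gates .relu W z) W a L))) ∂(initLaw P L d) := by
          refine lintegral_mono fun W => ?_
          rw [mul_left_comm, ← ENNReal.ofReal_mul (frobSq_nonneg B)]
          gcongr
          exact frobSq_mul_le _ _
      _ ≤ _ := by
          rw [lintegral_const_mul _ hm]
          refine (mul_le_mul_right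
            (hP.lintegral_frobSq_chain_le .relu hg hdep z haL le_rfl) _).trans_eq ?_
          rw [← mul_assoc, ← ENNReal.ofReal_mul (frobSq_nonneg B)]
          congr 2
          simp only [Activation.widthFactor]
          ring

theorem IsInitLaw.lintegral_sqSum_chain_le (hP : IsInitLaw P σ) (act : Activation)
    (z : Fin d → ℝ) {b : ℕ} (hb : b ≤ L) :
    ∫⁻ W, ENNReal.ofReal (sqSum (chain (gates act W z) W 0 b *ᵥ z)) ∂(initLaw P L d) ≤
      ENNReal.ofReal (lam act d σ ^ b * sqSum z) := by
  have := hP.isProbabilityMeasure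
  have := isProbabilityMeasure_initLaw (P := P) (L := L) (d := d)
  simpa using hP.lintegral_chain_mulVec_le act (g := fun _ => 1) measurable_const (a := 0)
    (fun _ _ _ => rfl) z z (Nat.zero_le b) hb

/-- If the last factor `T` of the first derivative is controlled, so is the derivative. -/
theorem IsInitLaw.lintegral_first_le (hP : IsInitLaw P σ) (act : Activation) (z : Fin d → ℝ)
    (k : Fin L) {T : Weights L d → ℝ≥0∞} {K : ℝ} (hK : 0 ≤ K)
    (hle : ∀ g : Weights L d → ℝ≥0∞, Measurable g → DependsBelow (k + 1) g →
      ∫⁻ W, g W * T W ∂(initLaw P L d) ≤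
        ENNReal.ofReal (K * lam act d σ ^ (L - (k + 1))) * ∫⁻ W, g W ∂(initLaw P L d)) :
    ∫⁻ W, ENNReal.ofReal (sqSum (chain (gates act W z) W 0 k *ᵥ z)) * T W ∂(initLaw P L d) ≤
      ENNReal.ofReal (K * lam act d σ ^ (L - 1) * sqSum z) := by
  have hl := lam_nonneg act d σ
  refine (hle _ (measurable_sqSum_chain_weights act z z 0 k) (((dependsBelow_chain act z 0 k).comp
    fun M => ENNReal.ofReal (sqSum (M *ᵥ z))).mono (Nat.le_succ _))).trans ?_
  refine (mul_le_mul_right (hP.lintegral_sqSum_chain_le act z k.2.le) _).trans_eq ?_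
  rw [← ENNReal.ofReal_mul (by positivity)]
  -- Layer `k` itself is differentiated away: `L - (k + 1)` layers remain above it and `k` below.
  have : L - 1 = L - (k + 1) + k := by omega
  rw [this, pow_add]
  congr 1
  ring

/-- If the last factor `T` of the second derivative is controlled, so is the derivative. -/
theorem IsInitLaw.lintegral_second_le (hP : IsInitLaw P σ) (act : Activation) (z : Fin d → ℝ)
    {k l : Fin L} (hkl : k < l) {T : Weights L d → ℝ≥0∞} {K : ℝ} (hK : 0 ≤ K)
    (hle : ∀ g : Weights L d → ℝ≥0∞, Measurable g → DependsBelow (l + 1) g →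
      ∫⁻ W, g W * T W ∂(initLaw P L d) ≤
        ENNReal.ofReal (K * lam act d σ ^ (L - (l + 1))) * ∫⁻ W, g W ∂(initLaw P L d)) :
    ∫⁻ W, (ENNReal.ofReal (sqSum (chain (gates act W z) W 0 k *ᵥ z)) *
        ENNReal.ofReal (frobSq (chain (gates act W z) W (k + 1) l))) * T W ∂(initLaw P L d) ≤
      ENNReal.ofReal (K * d * lam act d σ ^ (L - 2) * sqSum z) := by
  have hl := lam_nonneg act d σ
  have hkl' : (k : ℕ) < l := hkl
  have h0 := (dependsBelow_chain (L := L) act z 0 k).comp fun M => ENNReal.ofReal (sqSum (M *ᵥ z))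
  have h1 := (dependsBelow_chain (L := L) act z (k + 1) l).comp fun M => ENNReal.ofReal (frobSq M)
  have hm0 := measurable_sqSum_chain_weights (L := L) act z z 0 k
  have hm1 := measurable_frobSq_chain_weights (L := L) act z (k + 1) l
  refine (hle _ (hm0.mul hm1) ?_).trans ?_
  · exact fun W V h => congrArg₂ (· * ·) (h0 W V fun j hj => h j (by omega))
      (h1 W V fun j hj => h j (by omega))
  refine (mul_le_mul_right ((hP.lintegral_frobSq_chain_le act hm0 (h0.mono (Nat.le_succ _)) z
    (Nat.succ_le_of_lt hkl') l.2.le).trans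
      (mul_le_mul_right (hP.lintegral_sqSum_chain_le act z k.2.le) _)) _).trans_eq ?_
  rw [← ENNReal.ofReal_mul (by positivity), ← ENNReal.ofReal_mul (by positivity)]
  -- Layers above, between and below the two that are differentiated.
  have : L - 2 = L - (l + 1) + (l - (k + 1)) + k := by omega
  rw [this, pow_add, pow_add]
  congr 1
  ring

theorem widthFactor_nonneg (act : Activation) (d : ℕ) : 0 ≤ act.widthFactor d := by
  cases act <;> simp [Activation.widthFactor]

theorem IsInitLaw.lintegral_netOut_le (hP : IsInitLaw P σ) (act : Activation)
    (B : Matrix (Fin dOut) (Fin d) ℝ) (z : Fin d → ℝ) :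
    ∫⁻ W, ENNReal.ofReal (sqSum (netOut act B z W)) ∂(initLaw P L d) ≤
      ENNReal.ofReal (frobSq B * (lam act d σ ^ L * sqSum z)) := by
  rw [ENNReal.ofReal_mul (frobSq_nonneg B)]
  refine le_trans ?_ (mul_le_mul_right (hP.lintegral_sqSum_chain_le act z le_rfl) _)
  rw [← lintegral_const_mul _ (measurable_sqSum_chain_weights act z z 0 L)]
  refine lintegral_mono fun W => ?_
  rw [← ENNReal.ofReal_mul (frobSq_nonneg B)]
  exact ENNReal.ofReal_le_ofReal (sqSum_mulVec_le _ _)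

theorem IsInitLaw.lintegral_ampSq_le (hP : IsInitLaw P σ) (act : Activation)
    (B : Matrix (Fin dOut) (Fin d) ℝ) (z : Fin d → ℝ) (k : Fin L) :
    ∫⁻ W, ENNReal.ofReal (ampSq act B z W k) ∂(initLaw P L d) ≤
      ENNReal.ofReal (act.widthFactor d * frobSq B * lam act d σ ^ (L - 1) * sqSum z) := by
  refine le_trans (le_of_eq ?_) (hP.lintegral_first_le act z k
    (mul_nonneg (widthFactor_nonneg act d) (frobSq_nonneg B))
    fun g hg hdep => hP.lintegral_frobSq_mul_chain_le act B hg hdep z k.2)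
  exact lintegral_congr fun W => by rw [ampSq, ENNReal.ofReal_mul (frobSq_nonneg _), mul_comm]

theorem IsInitLaw.lintegral_ampSq₂_le (hP : IsInitLaw P σ) (act : Activation)
    (B : Matrix (Fin dOut) (Fin d) ℝ) (z : Fin d → ℝ) {k l : Fin L} (hkl : k < l) :
    ∫⁻ W, ENNReal.ofReal (ampSq₂ act B z W k l) ∂(initLaw P L d) ≤
      ENNReal.ofReal (act.widthFactor d * frobSq B * d * lam act d σ ^ (L - 2) * sqSum z) := by
  refine le_trans (le_of_eq ?_) (hP.lintegral_second_le act z hkl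
    (mul_nonneg (widthFactor_nonneg act d) (frobSq_nonneg B))
    fun g hg hdep => hP.lintegral_frobSq_mul_chain_le act B hg hdep z l.2)
  exact lintegral_congr fun W => by
    rw [ampSq₂, ENNReal.ofReal_mul (frobSq_nonneg _), ENNReal.ofReal_mul (frobSq_nonneg _)]
    ring

end ChainProducts

/-! ### The same second moments for random `A`, `B`. -/

section JointLaw

variable {L d dIn dOut n : ℕ} {P : Measure ℝ} {σ : ℝ}

theorem isProbabilityMeasure_jointLaw [IsProbabilityMeasure P] :
    IsProbabilityMeasure (jointLaw P dIn dOut d L) := by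
  have := isProbabilityMeasure_initLaw (P := P) (L := L) (d := d)
  unfold jointLaw
  infer_instance

/-- Integrating out the output matrix, then the hidden layers, then the input matrix. -/
theorem IsInitLaw.lintegral_jointLaw_le (hP : IsInitLaw P σ)
    {F : Matrix (Fin dOut) (Fin d) ℝ → (Fin d → ℝ) → Weights L d → ℝ≥0∞}
    {G : (Fin d → ℝ) → Weights L d → ℝ≥0∞} {K : ℝ} (hK : 0 ≤ K) (v : Fin dIn → ℝ)
    (hF : Measurable fun θ : (Fin d → Fin dIn → ℝ) × (Fin dOut → Fin d → ℝ) × Weights L d =>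
      F (Matrix.of θ.2.1) (Matrix.of θ.1 *ᵥ v) θ.2.2)
    (hG : ∀ z, Measurable (G z))
    (hB : ∀ z W, ∫⁻ B, F (Matrix.of B) z W ∂(matLaw P dOut d) ≤
      ENNReal.ofReal (dOut * σ ^ 2) * G z W)
    (hGle : ∀ z, ∫⁻ W, G z W ∂(initLaw P L d) ≤ ENNReal.ofReal (K * sqSum z)) :
    ∫⁻ θ, F (Matrix.of θ.2.1) (Matrix.of θ.1 *ᵥ v) θ.2.2 ∂(jointLaw P dIn dOut d L) ≤
      ENNReal.ofReal (dOut * σ ^ 2 * K * (d * σ ^ 2 * sqSum v)) := by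
  have := hP.isProbabilityMeasure
  have := isProbabilityMeasure_initLaw (P := P) (L := L) (d := d)
  rw [jointLaw, lintegral_prod _ hF.aemeasurable]
  have hA : ∀ A : Fin d → Fin dIn → ℝ,
      ∫⁻ q, F (Matrix.of q.1) (Matrix.of A *ᵥ v) q.2
        ∂((matLaw P dOut d).prod (initLaw P L d)) ≤
      ENNReal.ofReal (dOut * σ ^ 2 * K) * ENNReal.ofReal (sqSum (Matrix.of A *ᵥ v)) := by
    intro A
    have hFA : Measurable fun q : (Fin dOut → Fin d → ℝ) × Weights L d =>
        F (Matrix.of q.1) (Matrix.of A *ᵥ v) q.2 := hF.comp measurable_prodMk_left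
    -- The order is swapped so that `B` is innermost, with the weights held fixed.
    rw [lintegral_prod_symm _ hFA.aemeasurable]
    refine (lintegral_mono fun W => hB _ W).trans ?_
    rw [lintegral_const_mul _ (hG _)]
    refine (mul_le_mul_right (hGle _) _).trans_eq ?_
    rw [← ENNReal.ofReal_mul (by positivity), ← ENNReal.ofReal_mul (by positivity), mul_assoc _ K]
  refine (lintegral_mono hA).trans ?_
  rw [lintegral_const_mul _ (measurable_sqSum (measurable_mulVec_apply v)).ennreal_ofReal,
    ENNReal.ofReal_mul (p := dOut * σ ^ 2 * K) (by positivity)]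
  exact mul_le_mul_right (hP.lintegral_mulVec_le v) _

variable (act : Activation)

theorem measurable_mulVec_fst (v : Fin dIn → ℝ) (i : Fin d) :
    Measurable fun θ : (Fin d → Fin dIn → ℝ) × (Fin dOut → Fin d → ℝ) × Weights L d =>
      (Matrix.of θ.1 *ᵥ v) i :=
  (measurable_mulVec_apply v i).comp measurable_fst

theorem measurable_of_snd_fst (o : Fin dOut) (i : Fin d) :
    Measurable fun θ : (Fin d → Fin dIn → ℝ) × (Fin dOut → Fin d → ℝ) × Weights L d =>
      Matrix.of θ.2.1 o i := by
  simp only [Matrix.of_apply]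
  fun_prop

theorem IsInitLaw.lintegral_jointLaw_netOut_le (hP : IsInitLaw P σ) (v : Fin dIn → ℝ) :
    ∫⁻ θ, ENNReal.ofReal (sqSum (netOut act (Matrix.of θ.2.1) (Matrix.of θ.1 *ᵥ v) θ.2.2))
        ∂(jointLaw P dIn dOut d L) ≤
      ENNReal.ofReal (dOut * σ ^ 2 * lam act d σ ^ L * (d * σ ^ 2 * sqSum v)) := by
  refine hP.lintegral_jointLaw_le
    (F := fun B z W => ENNReal.ofReal (sqSum (netOut act B z W)))
    (G := fun z W => ENNReal.ofReal (sqSum (chain (gates act W z) W 0 L *ᵥ z)))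
    (pow_nonneg (lam_nonneg act d σ) _) v ?_ (fun z => measurable_sqSum_chain_weights act z z 0 L)
    ?_ (fun z => hP.lintegral_sqSum_chain_le act z le_rfl)
  · exact (measurable_sqSum (measurable_netOut act (by fun_prop) (measurable_mulVec_fst v)
      measurable_of_snd_fst)).ennreal_ofReal
  · intro z W
    rw [← ENNReal.ofReal_mul (by positivity)]
    exact hP.lintegral_mulVec_le _

theorem IsInitLaw.lintegral_frobSq_mul_mul_le (hP : IsInitLaw P σ) {q : ℕ}
    (N : Matrix (Fin d) (Fin q) ℝ) (c : ℝ) :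
    ∫⁻ M, ENNReal.ofReal (frobSq (Matrix.of M * N) * c) ∂(matLaw P dOut d) ≤
      ENNReal.ofReal (dOut * σ ^ 2) * ENNReal.ofReal (frobSq N * c) := by
  have hm : Measurable fun M : Fin dOut → Fin d → ℝ =>
      ENNReal.ofReal (frobSq (Matrix.of M * N)) :=
    (measurable_frobSq (measurable_mul (N := fun _ => N)
      (fun i j => by simp only [Matrix.of_apply]; fun_prop)
      (fun _ _ => measurable_const))).ennreal_ofReal
  simp only [ENNReal.ofReal_mul (frobSq_nonneg _)]
  rw [lintegral_mul_const _ hm, ← mul_assoc]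
  gcongr
  rw [← ENNReal.ofReal_mul (by positivity)]
  exact hP.lintegral_frobSq_mul_le N

/-- Once `B` is averaged, the Frobenius norm of the upper chain costs `d` for either activation.
This `d` pairs with the `σ ^ 2` of `B`, which removes the width factor. -/
theorem IsInitLaw.lintegral_jointLaw_ampSq_le (hP : IsInitLaw P σ) (v : Fin dIn → ℝ)
    (k : Fin L) :
    ∫⁻ θ, ENNReal.ofReal (ampSq act (Matrix.of θ.2.1) (Matrix.of θ.1 *ᵥ v) θ.2.2 k)
        ∂(jointLaw P dIn dOut d L) ≤
      ENNReal.ofReal (dOut * σ ^ 2 * (d * lam act d σ ^ (L - 1)) * (d * σ ^ 2 * sqSum v)) := by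
  have hl := lam_nonneg act d σ
  refine hP.lintegral_jointLaw_le
    (F := fun B z W => ENNReal.ofReal (ampSq act B z W k))
    (G := fun z W => ENNReal.ofReal (frobSq (chain (gates act W z) W (k + 1) L) *
      sqSum (chain (gates act W z) W 0 k *ᵥ z)))
    (by positivity) v ?_ ?_ ?_ ?_
  · exact (measurable_ampSq act (by fun_prop) (measurable_mulVec_fst v)
      measurable_of_snd_fst k).ennreal_ofReal
  · intro z
    exact ((measurable_frobSq (measurable_chain_weights act z _ _)).mul
      (measurable_sqSum (measurable_chain_weights_mulVec act z z _ _))).ennreal_ofReal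
  · exact fun z W => hP.lintegral_frobSq_mul_mul_le _ _
  · intro z
    refine le_trans (le_of_eq ?_) (hP.lintegral_first_le act z k (Nat.cast_nonneg d)
      fun g hg hdep => hP.lintegral_frobSq_chain_le act hg hdep z k.2 le_rfl)
    exact lintegral_congr fun W => by rw [ENNReal.ofReal_mul (frobSq_nonneg _), mul_comm]

theorem IsInitLaw.lintegral_jointLaw_ampSq₂_le (hP : IsInitLaw P σ) (v : Fin dIn → ℝ)
    {k l : Fin L} (hkl : k < l) :
    ∫⁻ θ, ENNReal.ofReal (ampSq₂ act (Matrix.of θ.2.1) (Matrix.of θ.1 *ᵥ v) θ.2.2 k l)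
        ∂(jointLaw P dIn dOut d L) ≤
      ENNReal.ofReal (dOut * σ ^ 2 * (d * d * lam act d σ ^ (L - 2)) *
        (d * σ ^ 2 * sqSum v)) := by
  have hl := lam_nonneg act d σ
  refine hP.lintegral_jointLaw_le
    (F := fun B z W => ENNReal.ofReal (ampSq₂ act B z W k l))
    (G := fun z W => ENNReal.ofReal (frobSq (chain (gates act W z) W (l + 1) L) *
      (frobSq (chain (gates act W z) W (k + 1) l) * sqSum (chain (gates act W z) W 0 k *ᵥ z))))
    (by positivity) v ?_ ?_ ?_ ?_
  · exact (measurable_ampSq₂ act (by fun_prop) (measurable_mulVec_fst v)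
      measurable_of_snd_fst k l).ennreal_ofReal
  · intro z
    exact ((measurable_frobSq (measurable_chain_weights act z _ _)).mul
      ((measurable_frobSq (measurable_chain_weights act z _ _)).mul
      (measurable_sqSum (measurable_chain_weights_mulVec act z z _ _)))).ennreal_ofReal
  · exact fun z W => hP.lintegral_frobSq_mul_mul_le _ _
  · intro z
    refine le_trans (le_of_eq ?_) (hP.lintegral_second_le act z hkl (Nat.cast_nonneg d)
      fun g hg hdep => hP.lintegral_frobSq_chain_le act hg hdep z l.2 le_rfl)
    exact lintegral_congr fun W => by
      rw [ENNReal.ofReal_mul (frobSq_nonneg _), ENNReal.ofReal_mul (frobSq_nonneg _)]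
      ring

end JointLaw

/-! ### From second moments to expected norms. -/

section Deduction

variable {Ω : Type*} [MeasurableSpace Ω] {μ : Measure Ω}

theorem integrable_and_integral_le_of_lintegral {X : Ω → ℝ} (hX : Measurable X)
    (h0 : ∀ ω, 0 ≤ X ω) {K : ℝ} (hK : 0 ≤ K)
    (h : ∫⁻ ω, ENNReal.ofReal (X ω) ∂μ ≤ ENNReal.ofReal K) :
    Integrable X μ ∧ ∫ ω, X ω ∂μ ≤ K := by
  have hi : Integrable X μ := (lintegral_ofReal_ne_top_iff_integrable hX.aestronglyMeasurable
    (ae_of_all _ h0)).1 (ne_top_of_le_ne_top ENNReal.ofReal_ne_top h)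
  refine ⟨hi, ?_⟩
  rwa [← ofReal_integral_eq_lintegral_ofReal hi (ae_of_all _ h0),
    ENNReal.ofReal_le_ofReal_iff hK] at h

/-- A quantity that is at most a mean over the samples, each with expectation at most `K`, has
expectation at most `K`. -/
theorem integrable_and_integral_le_of_mean {n : ℕ} {X : Ω → ℝ} {Y : Fin n → Ω → ℝ}
    (hX : Measurable X) (h0 : ∀ ω, 0 ≤ X ω) (hY : ∀ s, Measurable (Y s))
    (hY0 : ∀ s ω, 0 ≤ Y s ω) (hXY : ∀ ω, X ω ≤ 1 / (n : ℝ) * ∑ s, Y s ω) {K : ℝ} (hK : 0 ≤ K)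
    (h : ∀ s, ∫⁻ ω, ENNReal.ofReal (Y s ω) ∂μ ≤ ENNReal.ofReal K) :
    Integrable X μ ∧ ∫ ω, X ω ∂μ ≤ K := by
  have hYi := fun s => integrable_and_integral_le_of_lintegral (hY s) (hY0 s) hK (h s)
  have hsum : Integrable (fun ω => 1 / (n : ℝ) * ∑ s, Y s ω) μ :=
    (integrable_finsetSum _ fun s _ => (hYi s).1).const_mul _
  have hXi : Integrable X μ := hsum.mono' hX.aestronglyMeasurable
    (ae_of_all _ fun ω => by rw [Real.norm_of_nonneg (h0 ω)]; exact hXY ω)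
  refine ⟨hXi, (integral_mono hXi hsum hXY).trans ?_⟩
  rw [integral_const_mul, integral_finsetSum _ fun s _ => (hYi s).1]
  calc 1 / (n : ℝ) * ∑ s, ∫ ω, Y s ω ∂μ ≤ 1 / (n : ℝ) * ∑ _s : Fin n, K := by
        gcongr with s
        exact (hYi s).2
    _ ≤ K := by
        -- An empty mean is zero.
        rcases eq_or_ne (n : ℝ) 0 with hn | hn
        · simpa [hn] using hK
        · simp only [Finset.sum_const, Finset.card_univ, Fintype.card_fin, nsmul_eq_mul]
          rw [← mul_assoc, one_div_mul_cancel hn, one_mul]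

/-- Cauchy–Schwarz in expectation: the two factors may be dependent, and only their second moments
enter. -/
theorem lintegral_sqrt_mul_sqrt_le {f g : Ω → ℝ} (hf : Measurable f) (hg : Measurable g)
    (hf0 : ∀ ω, 0 ≤ f ω) (hg0 : ∀ ω, 0 ≤ g ω) {a b : ℝ}
    (ha : ∫⁻ ω, ENNReal.ofReal (f ω) ∂μ ≤ ENNReal.ofReal a)
    (hb : ∫⁻ ω, ENNReal.ofReal (g ω) ∂μ ≤ ENNReal.ofReal b) :
    ∫⁻ ω, ENNReal.ofReal (√(f ω) * √(g ω)) ∂μ ≤ ENNReal.ofReal (√a * √b) := by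
  have hsq : ∀ t : ℝ, 0 ≤ t → ENNReal.ofReal √t ^ (2 : ℝ) = ENNReal.ofReal t := by
    intro t ht
    rw [ENNReal.ofReal_rpow_of_nonneg (Real.sqrt_nonneg t) zero_le_two, Real.rpow_two,
      Real.sq_sqrt ht]
  have hroot : ∀ t : ℝ, ENNReal.ofReal t ^ (1 / 2 : ℝ) = ENNReal.ofReal √t := by
    intro t
    rcases le_total 0 t with ht | ht
    · rw [ENNReal.ofReal_rpow_of_nonneg ht (by norm_num), Real.sqrt_eq_rpow]
    · rw [ENNReal.ofReal_of_nonpos ht, Real.sqrt_eq_zero_of_nonpos ht, ENNReal.ofReal_zero]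
      simp
  have key := ENNReal.lintegral_mul_le_Lp_mul_Lq μ Real.HolderConjugate.two_two
    (f := fun ω => ENNReal.ofReal √(f ω)) (g := fun ω => ENNReal.ofReal √(g ω))
    hf.sqrt.ennreal_ofReal.aemeasurable hg.sqrt.ennreal_ofReal.aemeasurable
  simp only [hsq _ (hf0 _), hsq _ (hg0 _)] at key
  calc _ = ∫⁻ ω, ((fun ω => ENNReal.ofReal √(f ω)) * fun ω => ENNReal.ofReal √(g ω)) ω ∂μ :=
        lintegral_congr fun ω => ENNReal.ofReal_mul (Real.sqrt_nonneg _)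
    _ ≤ _ := key
    _ ≤ ENNReal.ofReal a ^ (1 / 2 : ℝ) * ENNReal.ofReal b ^ (1 / 2 : ℝ) := by gcongr
    _ = _ := by rw [hroot, hroot, ENNReal.ofReal_mul (Real.sqrt_nonneg _)]

theorem lintegral_sqrt_add_mul_sqrt_le [IsProbabilityMeasure μ] {f g : Ω → ℝ}
    (hf : Measurable f) (hg : Measurable g)
    (hf0 : ∀ ω, 0 ≤ f ω) (hg0 : ∀ ω, 0 ≤ g ω) {a b c S : ℝ} (hc : 0 ≤ c) (hcS : c ≤ S)
    (ha : ∫⁻ ω, ENNReal.ofReal (f ω) ∂μ ≤ ENNReal.ofReal a)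
    (hb : ∫⁻ ω, ENNReal.ofReal (g ω) ∂μ ≤ ENNReal.ofReal b) :
    ∫⁻ ω, ENNReal.ofReal ((√(f ω) + c) * √(g ω)) ∂μ ≤ ENNReal.ofReal ((√a + S) * √b) := by
  -- Cauchy–Schwarz against the constant `1`, on a probability space.
  have h1 : ∫⁻ ω, ENNReal.ofReal (√(g ω)) ∂μ ≤ ENNReal.ofReal √b := by
    have := lintegral_sqrt_mul_sqrt_le (μ := μ) (f := fun _ => 1) (a := 1) measurable_const hg
      (fun _ => zero_le_one) hg0 (by simp) hb
    simpa using this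
  have hm : Measurable fun ω => ENNReal.ofReal (√(f ω) * √(g ω)) :=
    (hf.sqrt.mul hg.sqrt).ennreal_ofReal
  calc _ = ∫⁻ ω, (ENNReal.ofReal (√(f ω) * √(g ω)) +
        ENNReal.ofReal c * ENNReal.ofReal (√(g ω))) ∂μ := lintegral_congr fun ω => by
        rw [add_mul, ENNReal.ofReal_add (by positivity) (by positivity), ENNReal.ofReal_mul hc]
    _ ≤ ENNReal.ofReal (√a * √b) + ENNReal.ofReal S * ENNReal.ofReal √b := by
        rw [lintegral_add_left hm, lintegral_const_mul _ hg.sqrt.ennreal_ofReal]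
        gcongr
        exact lintegral_sqrt_mul_sqrt_le hf hg hf0 hg0 ha hb
    _ = _ := by
        have : 0 ≤ S := hc.trans hcS
        rw [← ENNReal.ofReal_mul this, ← ENNReal.ofReal_add (by positivity) (by positivity),
          add_mul]

variable {L d dIn dOut n : ℕ} (act : Activation)

theorem ampSq_nonneg (B : Matrix (Fin dOut) (Fin d) ℝ) (z : Fin d → ℝ) (W : Weights L d) (k : ℕ) :
    0 ≤ ampSq act B z W k := mul_nonneg (frobSq_nonneg _) (sqSum_nonneg _)

theorem ampSq₂_nonneg (B : Matrix (Fin dOut) (Fin d) ℝ) (z : Fin d → ℝ) (W : Weights L d)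
    (k l : ℕ) : 0 ≤ ampSq₂ act B z W k l :=
  mul_nonneg (frobSq_nonneg _) (mul_nonneg (frobSq_nonneg _) (sqSum_nonneg _))

/-- Second moments of the output and of its derivatives control the expected norms of the gradient
and the Hessian of the loss. -/
theorem expected_norms_le [IsProbabilityMeasure μ] {W : Ω → Weights L d} (hW : Measurable W)
    {A : Ω → Matrix (Fin d) (Fin dIn) ℝ} (hA : ∀ i j, Measurable fun θ => A θ i j)
    {B : Ω → Matrix (Fin dOut) (Fin d) ℝ} (hB : ∀ o i, Measurable fun θ => B θ o i)
    (x : Fin n → Fin dIn → ℝ) (y : Fin n → Fin dOut → ℝ) {S e₀ e₁ e₂ : ℝ} (hS : 0 ≤ S)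
    (hy : ∀ s, euclNorm (y s) ≤ S)
    (h₀ : ∀ s, ∫⁻ θ, ENNReal.ofReal (sqSum (netOut act (B θ) (A θ *ᵥ x s) (W θ))) ∂μ ≤
      ENNReal.ofReal e₀)
    (h₁ : ∀ s (k : Fin L), ∫⁻ θ, ENNReal.ofReal (ampSq act (B θ) (A θ *ᵥ x s) (W θ) k) ∂μ ≤
      ENNReal.ofReal e₁)
    (h₂ : ∀ s (k l : Fin L), k < l →
      ∫⁻ θ, ENNReal.ofReal (ampSq₂ act (B θ) (A θ *ᵥ x s) (W θ) k l) ∂μ ≤ ENNReal.ofReal e₂) :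
    (∀ k, Integrable (fun θ => gradNorm act (A θ) (B θ) x y (W θ) k) μ ∧
      ∫ θ, gradNorm act (A θ) (B θ) x y (W θ) k ∂μ ≤ (√e₀ + S) * √e₁) ∧
    (∀ k, Integrable (fun θ => hessNorm act (A θ) (B θ) x y (W θ) k k) μ ∧
      ∫ θ, hessNorm act (A θ) (B θ) x y (W θ) k k ∂μ ≤ √e₁ * √e₁) ∧
    (∀ k l, k ≠ l → Integrable (fun θ => hessNorm act (A θ) (B θ) x y (W θ) k l) μ ∧
      ∫ θ, hessNorm act (A θ) (B θ) x y (W θ) k l ∂μ ≤ √e₁ * √e₁ + (√e₀ + S) * √e₂) := by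
  have hz : ∀ s i, Measurable fun θ => (A θ *ᵥ x s) i := fun s =>
    measurable_mulVec hA fun _ => measurable_const
  have m₀ := fun s => measurable_sqSum (measurable_netOut act hW (hz s) hB)
  have m₁ := fun s k => measurable_ampSq act hW (hz s) hB k
  have m₂ := fun s k l => measurable_ampSq₂ act hW (hz s) hB k l
  have hen : ∀ s, 0 ≤ euclNorm (y s) := fun s => euclNorm_nonneg _
  refine ⟨fun k => ?_, fun k => ?_, fun k l hkl => ?_⟩
  · refine integrable_and_integral_le_of_mean (measurable_gradNorm act hW hA hB x y k)
      (fun _ => frobNorm_nonneg _) (Y := fun s θ => (√(sqSum (netOut act (B θ) (A θ *ᵥ x s) (W θ))) +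
        euclNorm (y s)) * √(ampSq act (B θ) (A θ *ᵥ x s) (W θ) k))
      (fun s => ((m₀ s).sqrt.add_const _).mul (m₁ s k).sqrt)
      (fun s θ => mul_nonneg (add_nonneg (Real.sqrt_nonneg _) (hen s)) (Real.sqrt_nonneg _))
      (fun θ => gradNorm_le act _ _ x y _ k) (by positivity) fun s => ?_
    exact lintegral_sqrt_add_mul_sqrt_le (m₀ s) (m₁ s k) (fun _ => sqSum_nonneg _)
      (fun _ => ampSq_nonneg _ _ _ _ _) (hen s) (hy s) (h₀ s) (h₁ s k)
  · refine integrable_and_integral_le_of_mean (measurable_hessNorm act hW hA hB x y k k)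
      (fun _ => frobNorm_nonneg _) (fun s => (m₁ s k).sqrt.mul (m₁ s k).sqrt)
      (fun s θ => mul_nonneg (Real.sqrt_nonneg _) (Real.sqrt_nonneg _))
      (fun θ => hessNorm_self_le act _ _ x y _ k) (by positivity) fun s => ?_
    exact lintegral_sqrt_mul_sqrt_le (m₁ s k) (m₁ s k)
      (fun _ => ampSq_nonneg _ _ _ _ _) (fun _ => ampSq_nonneg _ _ _ _ _) (h₁ s k) (h₁ s k)
  · wlog hlt : k < l generalizing k l
    · simp only [hessNorm_comm act _ _ x y _ k l]
      exact this l k hkl.symm (lt_of_le_of_ne (not_lt.mp hlt) hkl.symm)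
    have mm : ∀ s, Measurable fun θ => √(ampSq act (B θ) (A θ *ᵥ x s) (W θ) k) *
        √(ampSq act (B θ) (A θ *ᵥ x s) (W θ) l) := fun s => (m₁ s k).sqrt.mul (m₁ s l).sqrt
    have nn : ∀ s θ, 0 ≤ (√(sqSum (netOut act (B θ) (A θ *ᵥ x s) (W θ))) + euclNorm (y s)) *
        √(ampSq₂ act (B θ) (A θ *ᵥ x s) (W θ) k l) := fun s θ =>
      mul_nonneg (add_nonneg (Real.sqrt_nonneg _) (hen s)) (Real.sqrt_nonneg _)
    refine integrable_and_integral_le_of_mean (measurable_hessNorm act hW hA hB x y k l)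
      (fun _ => frobNorm_nonneg _) (Y := fun s θ => √(ampSq act (B θ) (A θ *ᵥ x s) (W θ) k) *
        √(ampSq act (B θ) (A θ *ᵥ x s) (W θ) l) +
        (√(sqSum (netOut act (B θ) (A θ *ᵥ x s) (W θ))) +
        euclNorm (y s)) * √(ampSq₂ act (B θ) (A θ *ᵥ x s) (W θ) k l))
      (fun s => (mm s).add (((m₀ s).sqrt.add_const _).mul (m₂ s k l).sqrt))
      (fun s θ => add_nonneg (mul_nonneg (Real.sqrt_nonneg _) (Real.sqrt_nonneg _)) (nn s θ))
      (fun θ => hessNorm_le_of_lt act _ _ x y _ hlt) (by positivity) fun s => ?_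
    simp only [ENNReal.ofReal_add (mul_nonneg (Real.sqrt_nonneg _) (Real.sqrt_nonneg _)) (nn s _)]
    rw [lintegral_add_left (mm s).ennreal_ofReal,
      ENNReal.ofReal_add (by positivity) (by positivity)]
    refine add_le_add (lintegral_sqrt_mul_sqrt_le (m₁ s k) (m₁ s l)
      (fun _ => ampSq_nonneg _ _ _ _ _) (fun _ => ampSq_nonneg _ _ _ _ _) (h₁ s k) (h₁ s l)) ?_
    exact lintegral_sqrt_add_mul_sqrt_le (m₀ s) (m₂ s k l) (fun _ => sqSum_nonneg _)
      (fun _ => ampSq₂_nonneg _ _ _ _ _ _) (hen s) (hy s) (h₀ s) (h₂ s k l hlt)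

end Deduction

/-! ### Local constancy of the gates almost everywhere. -/

section AlmostEverywhere

open Filter Topology

variable {L d dIn dOut n : ℕ} {P : Measure ℝ}

/-- Along a coordinate `j` with `h j ≠ 0`, the others being frozen, the hyperplane is met in a
single point, which is not an atom. -/
theorem rowLaw_dotProduct_eq_zero [IsProbabilityMeasure P] (hP : ∀ t : ℝ, P {t} = 0)
    {h : Fin d → ℝ} (hne : h ≠ 0) : rowLaw P d {w | w ⬝ᵥ h = 0} = 0 := by
  obtain ⟨j, hj⟩ : ∃ j, h j ≠ 0 := by
    by_contra! hh
    exact hne (funext hh)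
  have hm : MeasurableSet {w : Fin d → ℝ | w ⬝ᵥ h = 0} :=
    measurable_dotProduct_right h (measurableSet_singleton 0)
  have hmi : Measurable ({w : Fin d → ℝ | w ⬝ᵥ h = 0}.indicator (1 : (Fin d → ℝ) → ℝ≥0∞)) :=
    measurable_one.indicator hm
  rw [← lintegral_indicator_one hm, lintegral_pi_update (fun _ => P) hmi j]
  rw [lintegral_eq_zero_iff' ?_]
  swap
  · exact (Measurable.lintegral_prod_right' (f := fun p : (Fin d → ℝ) × ℝ =>
      ({w : Fin d → ℝ | w ⬝ᵥ h = 0}.indicator (1 : (Fin d → ℝ) → ℝ≥0∞))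
        (Function.update p.1 j p.2)) (hmi.comp measurable_update')).aemeasurable
  refine ae_of_all _ fun w => ?_
  have hsub : ∀ t, Function.update w j t ⬝ᵥ h = (t - w j) * h j + w ⬝ᵥ h := by
    intro t
    have : Function.update w j t = w + Pi.single j (t - w j) := by
      ext i
      by_cases hi : i = j
      · subst hi; simp
      · simp [hi]
    rw [this, add_dotProduct, single_dotProduct, add_comm]
  have hle : ∀ t, ({w : Fin d → ℝ | w ⬝ᵥ h = 0}.indicator (1 : (Fin d → ℝ) → ℝ≥0∞))
      (Function.update w j t) ≤ ({w j - w ⬝ᵥ h / h j} : Set ℝ).indicator 1 t := by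
    intro t
    by_cases ht : Function.update w j t ⬝ᵥ h = 0
    · have : t = w j - w ⬝ᵥ h / h j := by
        rw [hsub] at ht
        field_simp
        linarith
      rw [Set.indicator_of_mem (show t ∈ ({w j - w ⬝ᵥ h / h j} : Set ℝ) from this)]
      exact Set.indicator_le_self' (fun _ _ => zero_le) _
    · rw [Set.indicator_of_notMem (by exact ht)]
      exact zero_le
  refine le_antisymm ((lintegral_mono hle).trans ?_) zero_le
  rw [lintegral_indicator_one (measurableSet_singleton _), hP]
  rfl

/-- Almost surely, a unit of positive depth has preactivation zero only if the layer below is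
off. -/
theorem ae_preact_ne_zero [IsProbabilityMeasure P] (act : Activation) (hP : ∀ t : ℝ, P {t} = 0)
    (z : Fin d → ℝ) (b : Fin L) (i : Fin d) :
    ∀ᵐ W ∂(initLaw P L d), (fun j => act.apply (preact act W z b j)) ≠ 0 →
      preact act W z (b + 1) i ≠ 0 := by
  have hmp : ∀ b j, Measurable fun W : Weights L d => preact act W z b j := fun b j =>
    measurable_preact act (W := fun W => W) (z := fun _ => z) measurable_id
      (fun _ => measurable_const) b j
  have hh : Measurable fun (W : Weights L d) j => act.apply (preact act W z b j) :=
    measurable_pi_lambda _ fun j => act.measurable_apply.comp (hmp b j)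
  have hms : MeasurableSet {W : Weights L d | (fun j => act.apply (preact act W z b j)) ≠ 0 ∧
      preact act W z (b + 1) i = 0} :=
    (hh (measurableSet_singleton 0)).compl.inter (hmp (b + 1) i (measurableSet_singleton 0))
  have hset : {W : Weights L d | ¬((fun j => act.apply (preact act W z b j)) ≠ 0 →
      preact act W z (b + 1) i ≠ 0)} = {W | (fun j => act.apply (preact act W z b j)) ≠ 0 ∧
      preact act W z (b + 1) i = 0} := by
    ext W; simp
  rw [ae_iff, hset, ← lintegral_indicator_one hms, initLaw,
    lintegral_pi_update _ (measurable_one.indicator hms) b]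
  refine (lintegral_congr fun W => ?_).trans lintegral_zero
  have hb : ∀ w, preact act (Function.update W b w) z b = preact act W z b :=
    (dependsBelow_preact act z b).update W le_rfl
  -- If the layer below is off, there is nothing to exclude. Otherwise row `i` of the fresh layer
  -- must lie on a fixed hyperplane.
  by_cases hne : (fun j => act.apply (preact act W z b j)) = 0
  · refine (lintegral_congr fun w => ?_).trans lintegral_zero
    refine Set.indicator_of_notMem ?_ _
    rw [Set.mem_ofPred_eq, hb]
    exact fun h => h.1 hne
  · have hm0 : MeasurableSet {w : Fin d → ℝ |
        w ⬝ᵥ (fun j => act.apply (preact act W z b j)) = 0} :=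
      measurable_dotProduct_right _ (measurableSet_singleton 0)
    have h0 := rowLaw_dotProduct_eq_zero hP hne
    rw [← lintegral_indicator_one hm0,
      ← lintegral_matLaw_row (m := d) (measurable_one.indicator hm0) i] at h0
    refine le_antisymm ((lintegral_mono fun w => ?_).trans h0.le) zero_le
    by_cases hw : Function.update W b w ∈ {W : Weights L d |
        (fun j => act.apply (preact act W z b j)) ≠ 0 ∧ preact act W z (b + 1) i = 0}
    · have hpre := hw.2
      simp only [preact_succ, layer_update_self, hb] at hpre
      have hmem : w i ∈ {w : Fin d → ℝ | w ⬝ᵥ (fun j => act.apply (preact act W z b j)) = 0} :=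
        hpre
      rw [Set.indicator_of_mem hw, Set.indicator_of_mem hmem]
      rfl
    · rw [Set.indicator_of_notMem hw]
      exact zero_le

theorem continuous_layer (b : ℕ) (i j : Fin d) :
    Continuous fun W : Weights L d => layer W b i j := by
  by_cases h : b < L
  · simp only [layer, h, dite_true, Matrix.of_apply]
    fun_prop
  · simp only [layer, h, dite_false]
    exact continuous_const

theorem Activation.continuous_apply (act : Activation) : Continuous act.apply := by
  cases act with
  | linear => exact continuous_id
  | relu => exact continuous_id.max continuous_const

theorem continuous_preact (act : Activation) (z : Fin d → ℝ) (b : ℕ) (i : Fin d) :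
    Continuous fun W : Weights L d => preact act W z b i := by
  induction b generalizing i with
  | zero => exact continuous_const
  | succ b ih =>
    have := fun j => act.continuous_apply.comp (ih j)
    have h2 := continuous_layer (L := L) (d := d) b
    simp only [preact_succ, Matrix.mulVec, dotProduct]
    exact continuous_finsetSum _ fun j _ => (h2 i j).mul (this j)

theorem Activation.eventually_gate_eq (act : Activation) {t : ℝ} (ht : t ≠ 0) :
    ∀ᶠ s in 𝓝 t, act.gate s = act.gate t := by
  cases act with
  | linear => exact Eventually.of_forall fun _ => rfl
  | relu =>
    rcases lt_or_gt_of_ne ht with h | h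
    · filter_upwards [eventually_lt_nhds h] with s hs
      simp [gate, not_lt.mpr hs.le, not_lt.mpr h.le]
    · filter_upwards [eventually_gt_nhds h] with s hs
      simp [gate, hs, h]

/-- Near weights for which preactivations vanish only above layers that are off, the gates are
constant. -/
theorem eventually_gates_eq {W : Weights L d} {z : Fin d → ℝ}
    (h : ∀ (b : Fin L) i, (fun j => Activation.relu.apply (preact .relu W z b j)) ≠ 0 →
      preact .relu W z (b + 1) i ≠ 0) (b : ℕ) :
    ∀ᶠ V in 𝓝 W, gates .relu V z b = gates .relu W z b := by
  induction b with
  | zero => exact Eventually.of_forall fun _ => rfl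
  | succ b ih =>
    have zero_case : (∀ V : Weights L d, gates .relu V z b = gates .relu W z b →
        preact .relu V z (b + 1) = 0) →
        ∀ᶠ V in 𝓝 W, gates .relu V z (b + 1) = gates .relu W z (b + 1) := by
      intro hz
      filter_upwards [ih] with V hV
      ext i
      simp only [gates, hz V hV, hz W rfl]
    by_cases hb : b < L
    -- If layer `b` is off at `W`, its gates are zero there and, by induction, nearby; the next
    -- preactivation then vanishes identically near `W`. Otherwise it is nonzero, and continuity
    -- fixes its sign.
    · by_cases hoff : (fun j => Activation.relu.apply (preact .relu W z b j)) = 0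
      · refine zero_case fun V hV => ?_
        rw [preact_succ]
        have : (fun i => Activation.relu.apply (preact .relu V z b i)) = 0 := by
          ext i
          have h1 : gates .relu W z b i = 0 := by
            have := congrFun hoff i
            simp only [Activation.apply, Pi.zero_apply, max_eq_right_iff] at this
            simp [gates, Activation.gate, not_lt.mpr this]
          have h2 := congrFun hV i
          rw [h1] at h2
          rw [← Activation.gate_mul_self]
          unfold gates at h2
          rw [h2, zero_mul]
          rfl
        rw [this, Matrix.mulVec_zero]
      · have hev : ∀ i, ∀ᶠ V in 𝓝 W, gates .relu V z (b + 1) i = gates .relu W z (b + 1) i :=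
          fun i => (continuous_preact (L := L) .relu z (b + 1) i).continuousAt.eventually
            (Activation.eventually_gate_eq .relu (h ⟨b, hb⟩ i hoff))
        filter_upwards [eventually_all.2 hev] with V hV
        exact funext hV
    · refine zero_case fun V _ => ?_
      rw [preact_succ]
      simp [layer, hb]

theorem contDiff_gatedLoss (act : Activation) (A : Matrix (Fin d) (Fin dIn) ℝ)
    (B : Matrix (Fin dOut) (Fin d) ℝ) (x : Fin n → Fin dIn → ℝ) (y : Fin n → Fin dOut → ℝ)
    (W : Weights L d) : ContDiff ℝ (⊤ : ℕ∞) (gatedLoss act A B x y W) := by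
  rw [gatedLoss_eq_chainLoss]
  exact contDiff_chainLoss _ _ _ _

/-- Where the gates are locally constant, the loss agrees locally with the gated loss. -/
theorem loss_eventuallyEq_gatedLoss (act : Activation) (A : Matrix (Fin d) (Fin dIn) ℝ)
    (B : Matrix (Fin dOut) (Fin d) ℝ) (x : Fin n → Fin dIn → ℝ) (y : Fin n → Fin dOut → ℝ)
    (W : Weights L d)
    (h : ∀ s b, ∀ᶠ V in 𝓝 W, gates act V (A *ᵥ x s) b = gates act W (A *ᵥ x s) b) :
    loss act A B x y =ᶠ[𝓝 W] gatedLoss act A B x y W := by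
  -- Only the levels up to `L` matter, so finitely many neighbourhoods are intersected.
  have hall : ∀ s, ∀ᶠ V in 𝓝 W, ∀ b : Fin (L + 1),
      gates act V (A *ᵥ x s) b = gates act W (A *ᵥ x s) b := fun s =>
    eventually_all.2 fun b => h s b
  filter_upwards [eventually_all.2 hall] with V hV
  have hchain : ∀ s b, b ≤ L → chain (gates act V (A *ᵥ x s)) V 0 b =
      chain (gates act W (A *ᵥ x s)) V 0 b := by
    intro s b hb
    induction b with
    | zero => simp only [chain, show gates act V (A *ᵥ x s) 0 = gates act W (A *ᵥ x s) 0 from hV s 0]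
    | succ b ih =>
      have := hV s ⟨b + 1, by omega⟩
      simp only at this
      rw [chain_succ _ _ b.zero_le, chain_succ _ _ b.zero_le, ih (by omega), this]
  rw [← gatedLoss_self, gatedLoss_eq_chainLoss, gatedLoss_eq_chainLoss]
  simp only [chainLoss, hchain _ L le_rfl]

theorem derivatives_eq_of_eventuallyEq {f g : Weights L d → ℝ} {W : Weights L d}
    (hg : ContDiff ℝ (⊤ : ℕ∞) g) (h : f =ᶠ[𝓝 W] g) :
    ContDiffAt ℝ (⊤ : ℕ∞) f W ∧ (∀ k, gradBlock f W k = gradBlock g W k) ∧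
      ∀ k l, hessBlock f W k l = hessBlock g W k l := by
  refine ⟨hg.contDiffAt.congr_of_eventuallyEq h, fun k => ?_, fun k l => ?_⟩
  · ext i j
    simp only [gradBlock, h.fderiv_eq]
  · ext a b
    have : (fun V => fderiv ℝ f V (unitWeight l b.1 b.2)) =ᶠ[𝓝 W]
        fun V => fderiv ℝ g V (unitWeight l b.1 b.2) := (h.fderiv (𝕜 := ℝ)).mono fun V hV => by
      simp only [hV]
    simp only [hessBlock, Matrix.of_apply, this.fderiv_eq]

theorem ae_derivatives_loss_eq {σ : ℝ} (act : Activation) (hP : IsInitLaw P σ)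
    (hact : act = Activation.linear ∨ ∀ t : ℝ, P {t} = 0) (A : Matrix (Fin d) (Fin dIn) ℝ)
    (B : Matrix (Fin dOut) (Fin d) ℝ) (x : Fin n → Fin dIn → ℝ) (y : Fin n → Fin dOut → ℝ) :
    ∀ᵐ W ∂(initLaw P L d),
      ContDiffAt ℝ (⊤ : ℕ∞) (loss act A B x y) W ∧
      (∀ k, gradBlock (loss act A B x y) W k = gradBlock (gatedLoss act A B x y W) W k) ∧
      ∀ k l, hessBlock (loss act A B x y) W k l = hessBlock (gatedLoss act A B x y W) W k l := by
  have := hP.isProbabilityMeasure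
  have key : ∀ᵐ W ∂(initLaw P L d), ∀ s b, ∀ᶠ V in 𝓝 W,
      gates act V (A *ᵥ x s) b = gates act W (A *ᵥ x s) b := by
    cases act with
    | linear => exact ae_of_all _ fun W s b => Eventually.of_forall fun V => rfl
    | relu =>
      have hatom : ∀ t : ℝ, P {t} = 0 := hact.resolve_left (by simp)
      have := ae_all_iff.2 fun s => ae_all_iff.2 fun b : Fin L => ae_all_iff.2 fun i =>
        ae_preact_ne_zero (P := P) .relu hatom (A *ᵥ x s) b i
      filter_upwards [this] with W hW s b
      exact eventually_gates_eq (hW s) b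
  filter_upwards [key] with W hW
  exact derivatives_eq_of_eventuallyEq (contDiff_gatedLoss act A B x y W)
    (loss_eventuallyEq_gatedLoss act A B x y W hW)

end AlmostEverywhere

/-! ### Powers of `λ` and explicit constants. -/

section ExplicitBounds

variable {L d dIn dOut n : ℕ} {P : Measure ℝ} {σ : ℝ}

theorem sqrt_pow_eq_rpow {t : ℝ} (ht : 0 ≤ t) (m : ℕ) : √(t ^ m) = t ^ ((m : ℝ) / 2) := by
  rw [Real.sqrt_eq_rpow, ← Real.rpow_natCast, ← Real.rpow_mul ht]
  congr 1
  ring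

theorem sqrt_eq_of_eq_mul_pow {t c w u : ℝ} {m : ℕ} (ht : 0 ≤ t) (hc : 0 ≤ c)
    (h : u = c ^ 2 * (w * t ^ m)) (hw : 0 ≤ w) : √u = c * (√w * t ^ ((m : ℝ) / 2)) := by
  rw [h, Real.sqrt_mul (sq_nonneg c), Real.sqrt_sq hc, Real.sqrt_mul hw, sqrt_pow_eq_rpow ht]

/-- Nonnegative exponents keep this valid at `t = 0`, a possible value of `λ`. -/
theorem rpow_mul_rpow_eq {t a b c : ℝ} (ht : 0 ≤ t) (ha : 0 ≤ a) (hb : 0 ≤ b) (h : a + b = c) :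
    t ^ a * t ^ b = t ^ c := by
  rw [← Real.rpow_add_of_nonneg ht ha hb, h]

theorem lam_zero (act : Activation) (σ : ℝ) : lam act 0 σ = 0 := by
  simp [lam]

theorem sqSum_le_sq {ι : Type*} [Fintype ι] {v : ι → ℝ} {R : ℝ} (h : euclNorm v ≤ R) :
    sqSum v ≤ |R| ^ 2 := by
  rw [sq_abs, ← Real.sq_sqrt (sqSum_nonneg v)]
  exact pow_le_pow_left₀ (Real.sqrt_nonneg _) h 2

theorem frobSq_le_sq {ι κ : Type*} [Fintype ι] [Fintype κ] {M : Matrix ι κ ℝ} {R : ℝ}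
    (h : frobNorm M ≤ R) : frobSq M ≤ |R| ^ 2 := by
  rw [sq_abs, ← Real.sq_sqrt (frobSq_nonneg M)]
  exact pow_le_pow_left₀ (Real.sqrt_nonneg _) h 2

/-- Puts the Gram term of an off-diagonal block under the prefactor of the residual term. For `d =
0` the prefactors need not compare, but `λ = 0` and the positive exponent annihilates both sides. -/
theorem widthFactor_mul_le (act : Activation) (d : ℕ) (σ : ℝ) {r : ℝ} (hr : 0 < r) :
    act.widthFactor d * lam act d σ ^ r ≤ √(d * act.widthFactor d) * lam act d σ ^ r := by
  rcases Nat.eq_zero_or_pos d with rfl | hd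
  · rw [lam_zero, Real.zero_rpow hr.ne', mul_zero, mul_zero]
  · refine mul_le_mul_of_nonneg_right ?_ (Real.rpow_nonneg (lam_nonneg act d σ) r)
    have h1 : (1 : ℝ) ≤ d := by exact_mod_cast hd
    cases act with
    | linear => simpa [Activation.widthFactor] using h1
    | relu => simp only [Activation.widthFactor]; rw [Real.sqrt_mul_self (by linarith)]

/-- With `S = |R|`, residual times first derivative yields `S ^ 3` and `S ^ 4`. The Gram term of an
off-diagonal block adds another `S ^ 4`, whence the factor `2` in `C`. -/
theorem expected_norms_fixed_le (hP : IsInitLaw P σ) (act : Activation) {R : ℝ}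
    {A : Matrix (Fin d) (Fin dIn) ℝ} {B : Matrix (Fin dOut) (Fin d) ℝ}
    {x : Fin n → Fin dIn → ℝ} {y : Fin n → Fin dOut → ℝ} (hB : frobNorm B ≤ R)
    (hx : ∀ s, euclNorm (A *ᵥ x s) ≤ R) (hy : ∀ s, euclNorm (y s) ≤ R) :
    let C := 2 * (|R| ^ 3 + |R| ^ 4)
    (∀ k : Fin L,
      Integrable (fun W => gradNorm act A B x y W k) (initLaw P L d) ∧
      ∫ W, gradNorm act A B x y W k ∂(initLaw P L d) ≤
        C * √(act.widthFactor d) *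
          (lam act d σ ^ (((L : ℝ) - 1) / 2) + lam act d σ ^ ((2 * (L : ℝ) - 1) / 2)) ∧
      (0 < lam act d σ → lam act d σ ≤ 1 →
        ∫ W, gradNorm act A B x y W k ∂(initLaw P L d) ≤
          C * √(act.widthFactor d / lam act d σ) * lam act d σ ^ ((L : ℝ) / 2))) ∧
    (∀ k : Fin L,
      Integrable (fun W => hessNorm act A B x y W k k) (initLaw P L d) ∧
      ∫ W, hessNorm act A B x y W k k ∂(initLaw P L d) ≤
        C * act.widthFactor d * lam act d σ ^ ((L : ℝ) - 1) ∧
      (0 < lam act d σ →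
        ∫ W, hessNorm act A B x y W k k ∂(initLaw P L d) ≤
          C * (act.widthFactor d / lam act d σ) * lam act d σ ^ (L : ℝ))) ∧
    (∀ k ℓ : Fin L, k ≠ ℓ →
      Integrable (fun W => hessNorm act A B x y W k ℓ) (initLaw P L d) ∧
      ∫ W, hessNorm act A B x y W k ℓ ∂(initLaw P L d) ≤
        C * √(d * act.widthFactor d) *
          (lam act d σ ^ (((L : ℝ) - 2) / 2) + lam act d σ ^ ((L : ℝ) - 1)) ∧
      (0 < lam act d σ → lam act d σ ≤ 1 →
        ∫ W, hessNorm act A B x y W k ℓ ∂(initLaw P L d) ≤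
          C * (√(d * act.widthFactor d) / lam act d σ) * lam act d σ ^ ((L : ℝ) / 2))) := by
  intro C
  have := hP.isProbabilityMeasure
  have := isProbabilityMeasure_initLaw (P := P) (L := L) (d := d)
  set S := |R| with hSdef
  set δ := act.widthFactor d with hδdef
  set t := lam act d σ with htdef
  have hS : 0 ≤ S := abs_nonneg R
  have hδ : 0 ≤ δ := widthFactor_nonneg act d
  have ht : 0 ≤ t := lam_nonneg act d σ
  have hC : 0 ≤ C := by positivity
  have hBS := frobSq_le_sq hB
  have hB0 := frobSq_nonneg B
  have hxS := fun s => sqSum_le_sq (hx s)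
  have hx0 := fun s => sqSum_nonneg (A *ᵥ x s)
  obtain ⟨H₁, H₂, H₃⟩ := expected_norms_le (μ := initLaw P L d) act (W := fun W => W)
    measurable_id (A := fun _ => A) (fun _ _ => measurable_const) (B := fun _ => B)
    (fun _ _ => measurable_const) x y (e₀ := S ^ 2 * (t ^ L * S ^ 2))
    (e₁ := δ * S ^ 2 * t ^ (L - 1) * S ^ 2) (e₂ := δ * S ^ 2 * d * t ^ (L - 2) * S ^ 2) hS
    (fun s => (hy s).trans (le_abs_self R))
    (fun s => (hP.lintegral_netOut_le act B _).trans (ENNReal.ofReal_le_ofReal (by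
      have := hxS s; have := hx0 s; gcongr)))
    (fun s k => (hP.lintegral_ampSq_le act B _ k).trans (ENNReal.ofReal_le_ofReal (by
      have := hxS s; have := hx0 s; gcongr)))
    (fun s k l hkl => (hP.lintegral_ampSq₂_le act B _ hkl).trans (ENNReal.ofReal_le_ofReal (by
      have := hxS s; have := hx0 s; gcongr)))
  have s₀ : √(S ^ 2 * (t ^ L * S ^ 2)) = S ^ 2 * (√1 * t ^ ((L : ℝ) / 2)) :=
    sqrt_eq_of_eq_mul_pow ht (by positivity) (by ring) zero_le_one
  rw [Real.sqrt_one, one_mul] at s₀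
  have s₁ : √(δ * S ^ 2 * t ^ (L - 1) * S ^ 2) = S ^ 2 * (√δ * t ^ (((L - 1 : ℕ) : ℝ) / 2)) :=
    sqrt_eq_of_eq_mul_pow ht (by positivity) (by ring) hδ
  have s₂ : √(δ * S ^ 2 * d * t ^ (L - 2) * S ^ 2) =
      S ^ 2 * (√(d * δ) * t ^ (((L - 2 : ℕ) : ℝ) / 2)) :=
    sqrt_eq_of_eq_mul_pow ht (by positivity) (by ring) (by positivity)
  rw [s₀, s₁] at H₁
  rw [Real.mul_self_sqrt (by positivity)] at H₂ H₃
  rw [s₀, s₂] at H₃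
  refine ⟨fun k => ?_, fun k => ?_, fun k l hkl => ?_⟩
  -- The existence of `k` makes the truncated difference `L - 1` a true one.
  · have hL : 1 ≤ L := k.pos
    have hL' : (1 : ℝ) ≤ L := by exact_mod_cast hL
    obtain ⟨hi, hle⟩ := H₁ k
    rw [Nat.cast_sub hL, Nat.cast_one] at hle
    set a := t ^ (((L : ℝ) - 1) / 2) with ha
    have ha0 : 0 ≤ a := Real.rpow_nonneg ht _
    have hb0 : 0 ≤ t ^ ((2 * (L : ℝ) - 1) / 2) := Real.rpow_nonneg ht _
    have hab : t ^ ((L : ℝ) / 2) * a = t ^ ((2 * (L : ℝ) - 1) / 2) :=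
      rpow_mul_rpow_eq ht (by linarith) (by linarith) (by ring)
    have hw : 0 ≤ √δ := Real.sqrt_nonneg _
    have hle' : ∫ W, gradNorm act A B x y W k ∂(initLaw P L d) ≤
        S ^ 4 * (√δ * t ^ ((2 * (L : ℝ) - 1) / 2)) + S ^ 3 * (√δ * a) := by
      refine hle.trans_eq ?_
      rw [← hab]
      ring
    have p1 : 0 ≤ S ^ 4 * (√δ * a) := by positivity
    have p2 : 0 ≤ S ^ 3 * (√δ * a) := by positivity
    refine ⟨hi, hle'.trans ?_, fun h0 h1 => hle'.trans ?_⟩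
    · have p3 : 0 ≤ S ^ 4 * (√δ * t ^ ((2 * (L : ℝ) - 1) / 2)) := by positivity
      have p4 : 0 ≤ S ^ 3 * (√δ * t ^ ((2 * (L : ℝ) - 1) / 2)) := by positivity
      simp only [C]
      linarith
    · have hba : t ^ ((2 * (L : ℝ) - 1) / 2) ≤ a :=
        Real.rpow_le_rpow_of_exponent_ge h0 h1 (by linarith)
      have e1 : √(δ / t) * t ^ ((L : ℝ) / 2) = √δ * a := by
        rw [Real.sqrt_div hδ, Real.sqrt_eq_rpow t, ha, sub_div, Real.rpow_sub h0]
        ring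
      rw [mul_assoc, e1]
      have p3 : S ^ 4 * (√δ * t ^ ((2 * (L : ℝ) - 1) / 2)) ≤ S ^ 4 * (√δ * a) := by gcongr
      simp only [C]
      linarith
  · have hL : 1 ≤ L := k.pos
    obtain ⟨hi, hle⟩ := H₂ k
    rw [← Real.rpow_natCast t (L - 1), Nat.cast_sub hL, Nat.cast_one] at hle
    have hle' : ∫ W, hessNorm act A B x y W k k ∂(initLaw P L d) ≤
        C * δ * t ^ ((L : ℝ) - 1) := by
      have hb0 : 0 ≤ t ^ ((L : ℝ) - 1) := Real.rpow_nonneg ht _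
      have p1 : 0 ≤ S ^ 4 * (δ * t ^ ((L : ℝ) - 1)) := by positivity
      have p2 : 0 ≤ S ^ 3 * (δ * t ^ ((L : ℝ) - 1)) := by positivity
      simp only [C]
      linarith
    refine ⟨hi, hle', fun h0 => hle'.trans_eq ?_⟩
    rw [Real.rpow_sub_one h0.ne']
    ring
  · have hL : 2 ≤ L := by
      have := Fin.val_ne_of_ne hkl
      omega
    have hL' : (2 : ℝ) ≤ L := by exact_mod_cast hL
    obtain ⟨hi, hle⟩ := H₃ k l hkl
    rw [← Real.rpow_natCast t (L - 1), Nat.cast_sub hL, Nat.cast_sub (by omega), Nat.cast_one,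
      Nat.cast_two] at hle
    set a := t ^ (((L : ℝ) - 2) / 2) with ha
    set b := t ^ ((L : ℝ) - 1) with hb
    set w := √(d * δ) with hwdef
    have ha0 : 0 ≤ a := Real.rpow_nonneg ht _
    have hb0 : 0 ≤ b := Real.rpow_nonneg ht _
    have hw : 0 ≤ w := Real.sqrt_nonneg _
    have hab : t ^ ((L : ℝ) / 2) * a = b :=
      rpow_mul_rpow_eq ht (by linarith) (by linarith) (by ring)
    have hδw : S ^ 4 * (δ * b) ≤ S ^ 4 * (w * b) :=
      mul_le_mul_of_nonneg_left (widthFactor_mul_le act d σ (by linarith)) (by positivity)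
    have hle' : ∫ W, hessNorm act A B x y W k l ∂(initLaw P L d) ≤
        2 * (S ^ 4 * (w * b)) + S ^ 3 * (w * a) := by
      have e : (S ^ 2 * t ^ ((L : ℝ) / 2) + S) * (S ^ 2 * (w * a)) =
          S ^ 4 * (w * b) + S ^ 3 * (w * a) := by
        rw [← hab]
        ring
      linarith
    have p1 : 0 ≤ S ^ 4 * (w * a) := by positivity
    have p2 : 0 ≤ S ^ 3 * (w * a) := by positivity
    refine ⟨hi, hle'.trans ?_, fun h0 h1 => hle'.trans ?_⟩
    · have p3 : 0 ≤ S ^ 3 * (w * b) := by positivity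
      simp only [C]
      linarith
    · have hba : b ≤ a := Real.rpow_le_rpow_of_exponent_ge h0 h1 (by linarith)
      have e1 : w / t * t ^ ((L : ℝ) / 2) = w * a := by
        rw [ha, sub_div, div_self two_ne_zero, Real.rpow_sub_one h0.ne']
        ring
      rw [mul_assoc, e1]
      have p3 : S ^ 4 * (w * b) ≤ S ^ 4 * (w * a) := by gcongr
      simp only [C]
      linarith

/-- Here `d * σ ^ 2 = λ / p` and `p ≥ 1 / 2`. -/
theorem natCast_mul_sq_le (act : Activation) (d : ℕ) (σ : ℝ) : d * σ ^ 2 ≤ 2 * lam act d σ := by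
  have : 0 ≤ d * σ ^ 2 := by positivity
  cases act <;> simp only [lam, Activation.p] <;> linarith

theorem sq_le_lam_div (act : Activation) {d : ℕ} (hd : d ≠ 0) (σ : ℝ) :
    σ ^ 2 ≤ 2 * lam act d σ * (d : ℝ)⁻¹ := by
  rw [← div_eq_mul_inv, le_div_iff₀ (by positivity), mul_comm]
  exact natCast_mul_sq_le act d σ

theorem inv_sqrt_natCast_le_one (d : ℕ) : √(d : ℝ)⁻¹ ≤ 1 := by
  exact Real.sqrt_le_iff.2 ⟨zero_le_one, by simpa using Nat.cast_inv_le_one (α := ℝ) d⟩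

theorem sqrt_inv_mul_sqrt_le_one (d : ℕ) : √(d : ℝ)⁻¹ * √(d : ℝ) ≤ 1 := by
  rw [← Real.sqrt_mul (by positivity)]
  exact Real.sqrt_le_iff.2 ⟨zero_le_one, by simpa using inv_mul_le_one⟩

/-- `A` contributes `d * σ ^ 2 ≤ 2 * λ`, and `B` contributes `dOut * σ ^ 2`. In the output moment no
sum over `d` basis vectors compensates this `σ ^ 2`, so a gain `1 / d` is left. It cancels the `√d`
of the mixed second derivative, and only the target term keeps `√d`. The off-diagonal case adds two
terms with coefficient `4 * dOut * |R| ^ 2`, whence the `8`. -/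
theorem expected_norms_random_le (hP : IsInitLaw P σ) (act : Activation) {R : ℝ}
    {x : Fin n → Fin dIn → ℝ} {y : Fin n → Fin dOut → ℝ}
    (hx : ∀ s, euclNorm (x s) ≤ R) (hy : ∀ s, euclNorm (y s) ≤ R) :
    let C := 8 * (√dOut ^ 2 + √dOut) * |R| ^ 2
    (∀ k : Fin L,
      Integrable (fun θ => gradNorm act (Matrix.of θ.1) (Matrix.of θ.2.1) x y θ.2.2 k)
        (jointLaw P dIn dOut d L) ∧
      ∫ θ, gradNorm act (Matrix.of θ.1) (Matrix.of θ.2.1) x y θ.2.2 k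
          ∂(jointLaw P dIn dOut d L) ≤
        C * (lam act d σ ^ (((L : ℝ) + 1) / 2) + lam act d σ ^ ((2 * (L : ℝ) + 3) / 2)) ∧
      (lam act d σ ≤ 1 →
        ∫ θ, gradNorm act (Matrix.of θ.1) (Matrix.of θ.2.1) x y θ.2.2 k
            ∂(jointLaw P dIn dOut d L) ≤
          C * lam act d σ ^ ((L : ℝ) / 2))) ∧
    (∀ k : Fin L,
      Integrable (fun θ => hessNorm act (Matrix.of θ.1) (Matrix.of θ.2.1) x y θ.2.2 k k)
        (jointLaw P dIn dOut d L) ∧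
      ∫ θ, hessNorm act (Matrix.of θ.1) (Matrix.of θ.2.1) x y θ.2.2 k k
          ∂(jointLaw P dIn dOut d L) ≤
        C * lam act d σ ^ ((L : ℝ) + 1) ∧
      (lam act d σ ≤ 1 →
        ∫ θ, hessNorm act (Matrix.of θ.1) (Matrix.of θ.2.1) x y θ.2.2 k k
            ∂(jointLaw P dIn dOut d L) ≤
          C * lam act d σ ^ (L : ℝ))) ∧
    (∀ k ℓ : Fin L, k ≠ ℓ →
      Integrable (fun θ => hessNorm act (Matrix.of θ.1) (Matrix.of θ.2.1) x y θ.2.2 k ℓ)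
        (jointLaw P dIn dOut d L) ∧
      ∫ θ, hessNorm act (Matrix.of θ.1) (Matrix.of θ.2.1) x y θ.2.2 k ℓ
          ∂(jointLaw P dIn dOut d L) ≤
        C * (√d * lam act d σ ^ ((L : ℝ) / 2) + lam act d σ ^ ((L : ℝ) + 1)) ∧
      (lam act d σ ≤ 1 →
        ∫ θ, hessNorm act (Matrix.of θ.1) (Matrix.of θ.2.1) x y θ.2.2 k ℓ
            ∂(jointLaw P dIn dOut d L) ≤
          C * √d * lam act d σ ^ ((L : ℝ) / 2))) := by
  intro C
  have := hP.isProbabilityMeasure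
  have := isProbabilityMeasure_jointLaw (P := P) (L := L) (d := d) (dIn := dIn) (dOut := dOut)
  set S := |R| with hSdef
  set t := lam act d σ with htdef
  set T := √(dOut : ℝ) with hTdef
  have hT2 : T ^ 2 = dOut := Real.sq_sqrt (Nat.cast_nonneg _)
  have hS : 0 ≤ S := abs_nonneg R
  have hT : 0 ≤ T := Real.sqrt_nonneg _
  have ht : 0 ≤ t := lam_nonneg act d σ
  have hC : 0 ≤ C := by positivity
  have hxS := fun s => sqSum_le_sq (hx s)
  have hx0 := fun s => sqSum_nonneg (x s)
  have hq : d * σ ^ 2 ≤ 2 * t := natCast_mul_sq_le act d σ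
  have hq0 : 0 ≤ d * σ ^ 2 := by positivity
  -- The square of `2` collects one factor from `A` and one from `B`. For `d = 0` both sides vanish,
  -- as `0⁻¹ = 0`.
  have b₀ : ∀ s, dOut * σ ^ 2 * t ^ L * (d * σ ^ 2 * sqSum (x s)) ≤
      (2 * T * S) ^ 2 * ((d : ℝ)⁻¹ * t ^ (L + 2)) := by
    intro s
    rcases eq_or_ne d 0 with hd | hd
    · simp [hd]
    · have h1 := sq_le_lam_div act hd σ
      have h2 := hxS s
      have h3 := hx0 s
      calc _ ≤ dOut * (2 * t * (d : ℝ)⁻¹) * t ^ L * (2 * t * S ^ 2) := by gcongr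
        _ = _ := by rw [← hT2]; ring
  have b₁ : L ≠ 0 → ∀ s, dOut * σ ^ 2 * (d * t ^ (L - 1)) * (d * σ ^ 2 * sqSum (x s)) ≤
      (2 * T * S) ^ 2 * (1 * t ^ (L + 1)) := by
    intro hL s
    have h2 := hxS s
    have h3 := hx0 s
    calc _ = dOut * (d * σ ^ 2) * t ^ (L - 1) * (d * σ ^ 2 * sqSum (x s)) := by ring
      _ ≤ dOut * (2 * t) * t ^ (L - 1) * (2 * t * S ^ 2) := by gcongr
      _ = _ := by
        have : L + 1 = L - 1 + 2 := by omega
        rw [← hT2, this]; ring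
  have b₂ : 2 ≤ L → ∀ s, dOut * σ ^ 2 * (d * d * t ^ (L - 2)) * (d * σ ^ 2 * sqSum (x s)) ≤
      (2 * T * S) ^ 2 * (d * t ^ L) := by
    intro hL s
    have h2 := hxS s
    have h3 := hx0 s
    calc _ = dOut * d * (d * σ ^ 2) * t ^ (L - 2) * (d * σ ^ 2 * sqSum (x s)) := by ring
      _ ≤ dOut * d * (2 * t) * t ^ (L - 2) * (2 * t * S ^ 2) := by gcongr
      _ = _ := by
        obtain ⟨m, rfl⟩ : ∃ m, L = m + 2 := ⟨L - 2, by omega⟩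
        rw [← hT2, Nat.add_sub_cancel]; ring
  obtain ⟨H₁, H₂, H₃⟩ := expected_norms_le (μ := jointLaw P dIn dOut d L) act
    (W := fun θ => θ.2.2) (by fun_prop) (A := fun θ => Matrix.of θ.1)
    (fun i j => by simp only [Matrix.of_apply]; fun_prop) (B := fun θ => Matrix.of θ.2.1)
    measurable_of_snd_fst x y hS (fun s => (hy s).trans (le_abs_self R))
    (fun s => (hP.lintegral_jointLaw_netOut_le act _).trans (ENNReal.ofReal_le_ofReal (b₀ s)))
    (fun s k => (hP.lintegral_jointLaw_ampSq_le act _ k).trans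
      (ENNReal.ofReal_le_ofReal (b₁ k.pos.ne' s)))
    (fun s k l hkl => (hP.lintegral_jointLaw_ampSq₂_le act _ hkl).trans
      (ENNReal.ofReal_le_ofReal (b₂ (by have : (k : ℕ) < l := hkl; omega) s)))
  have hTS : 0 ≤ 2 * T * S := by positivity
  rw [sqrt_eq_of_eq_mul_pow ht hTS rfl (by positivity),
    sqrt_eq_of_eq_mul_pow ht hTS rfl zero_le_one, Real.sqrt_one, one_mul] at H₁
  rw [Real.mul_self_sqrt (by positivity), one_mul] at H₂ H₃
  rw [sqrt_eq_of_eq_mul_pow ht hTS rfl (by positivity),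
    sqrt_eq_of_eq_mul_pow ht hTS rfl (by positivity)] at H₃
  have r0 := inv_sqrt_natCast_le_one d
  have r1 := sqrt_inv_mul_sqrt_le_one d
  have hL0 : (0 : ℝ) ≤ L := Nat.cast_nonneg L
  have hmono : ∀ {u v : ℝ}, t ≤ 1 → 0 ≤ v → v ≤ u → t ^ u ≤ t ^ v := fun h1 hv huv =>
    Real.rpow_le_rpow_of_exponent_ge' ht h1 hv huv
  have hrp : ∀ u : ℝ, 0 ≤ t ^ u := fun u => Real.rpow_nonneg ht u
  refine ⟨fun k => ?_, fun k => ?_, fun k l hkl => ?_⟩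
  · obtain ⟨hi, hle⟩ := H₁ k
    set a := t ^ (((L : ℝ) + 1) / 2) with ha
    set b := t ^ ((2 * (L : ℝ) + 3) / 2) with hb
    have hle' : ∫ θ, gradNorm act (Matrix.of θ.1) (Matrix.of θ.2.1) x y θ.2.2 k
        ∂(jointLaw P dIn dOut d L) ≤ 4 * T ^ 2 * S ^ 2 * b + 2 * T * S ^ 2 * a := by
      refine hle.trans ?_
      push_cast
      have hab : t ^ (((L : ℝ) + 2) / 2) * a = b :=
        rpow_mul_rpow_eq ht (by linarith) (by linarith) (by ring)
      calc _ = 4 * T ^ 2 * S ^ 2 * (√(d : ℝ)⁻¹ * (t ^ (((L : ℝ) + 2) / 2) * a)) +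
            2 * T * S ^ 2 * a := by ring
        _ ≤ _ := by
          rw [hab]
          gcongr
          exact mul_le_of_le_one_left (hrp _) r0
    have pa := hrp (((L : ℝ) + 1) / 2)
    have pb := hrp ((2 * (L : ℝ) + 3) / 2)
    rw [← ha] at pa
    rw [← hb] at pb
    have q1 : 0 ≤ T * S ^ 2 * a := by positivity
    have q2 : 0 ≤ T ^ 2 * S ^ 2 * b := by positivity
    have q3 : 0 ≤ T * S ^ 2 * b := by positivity
    have q4 : 0 ≤ T ^ 2 * S ^ 2 * a := by positivity
    refine ⟨hi, hle'.trans ?_, fun h1 => hle'.trans ?_⟩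
    · simp only [C]
      linarith
    · have hac : T * S ^ 2 * a ≤ T * S ^ 2 * t ^ ((L : ℝ) / 2) :=
        mul_le_mul_of_nonneg_left (hmono h1 (by linarith) (by linarith)) (by positivity)
      have hbc : T ^ 2 * S ^ 2 * b ≤ T ^ 2 * S ^ 2 * t ^ ((L : ℝ) / 2) :=
        mul_le_mul_of_nonneg_left (hmono h1 (by linarith) (by linarith)) (by positivity)
      simp only [C]
      linarith
  · obtain ⟨hi, hle⟩ := H₂ k
    rw [← Real.rpow_natCast t (L + 1), Nat.cast_add L 1, Nat.cast_one] at hle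
    have hle' : ∫ θ, hessNorm act (Matrix.of θ.1) (Matrix.of θ.2.1) x y θ.2.2 k k
        ∂(jointLaw P dIn dOut d L) ≤ C * t ^ ((L : ℝ) + 1) := by
      refine hle.trans ?_
      have pa := hrp ((L : ℝ) + 1)
      have q1 : 0 ≤ T * S ^ 2 * t ^ ((L : ℝ) + 1) := by positivity
      have q2 : 0 ≤ T ^ 2 * S ^ 2 * t ^ ((L : ℝ) + 1) := by positivity
      simp only [C]
      linarith
    exact ⟨hi, hle', fun h1 => hle'.trans
      (mul_le_mul_of_nonneg_left (hmono h1 hL0 (by linarith)) hC)⟩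
  · obtain ⟨hi, hle⟩ := H₃ k l hkl
    rw [← Real.rpow_natCast t (L + 1), Nat.cast_add L 1, Nat.cast_one] at hle
    set a := t ^ ((L : ℝ) / 2) with ha
    set b := t ^ ((L : ℝ) + 1) with hb
    have pa : 0 ≤ a := hrp _
    have pb : 0 ≤ b := hrp _
    have hle' : ∫ θ, hessNorm act (Matrix.of θ.1) (Matrix.of θ.2.1) x y θ.2.2 k l
        ∂(jointLaw P dIn dOut d L) ≤ 8 * T ^ 2 * S ^ 2 * b + 2 * T * S ^ 2 * (√d * a) := by
      refine hle.trans ?_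
      push_cast
      have hab : t ^ (((L : ℝ) + 2) / 2) * a = b :=
        rpow_mul_rpow_eq ht (by linarith) (by linarith) (by ring)
      calc _ = 4 * T ^ 2 * S ^ 2 * b + 4 * T ^ 2 * S ^ 2 *
            (√(d : ℝ)⁻¹ * √(d : ℝ) * (t ^ (((L : ℝ) + 2) / 2) * a)) +
            2 * T * S ^ 2 * (√d * a) := by ring
        _ ≤ 4 * T ^ 2 * S ^ 2 * b + 4 * T ^ 2 * S ^ 2 * b + 2 * T * S ^ 2 * (√d * a) := by
          rw [hab]
          gcongr
          exact mul_le_of_le_one_left pb r1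
        _ = _ := by ring
    have q1 : 0 ≤ T * S ^ 2 * (√d * a) := by positivity
    have q2 : 0 ≤ T ^ 2 * S ^ 2 * b := by positivity
    have q3 : 0 ≤ T * S ^ 2 * b := by positivity
    have q4 : 0 ≤ T ^ 2 * S ^ 2 * (√d * a) := by positivity
    refine ⟨hi, hle'.trans ?_, fun h1 => hle'.trans ?_⟩
    · simp only [C]
      linarith
    -- For `d = 0` the right side is zero, but so is `b`, because `λ = 0`.
    · have hba : b ≤ √d * a := by
        rcases Nat.eq_zero_or_pos d with hd | hd
        · have h0 : t = 0 := by rw [htdef, hd, lam_zero]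
          rw [hb, h0, Real.zero_rpow (by linarith)]
          positivity
        · have hd1 : 1 ≤ √(d : ℝ) := by
            rw [Real.one_le_sqrt]
            exact_mod_cast hd
          exact (hmono h1 (by linarith) (by linarith)).trans (le_mul_of_one_le_left pa hd1)
      have q5 : T ^ 2 * S ^ 2 * b ≤ T ^ 2 * S ^ 2 * (√d * a) :=
        mul_le_mul_of_nonneg_left hba (by positivity)
      simp only [C]
      linarith

end ExplicitBounds

end

theorem theorem3 (act : Activation) (R : ℝ) :
    -- fixed input and output matrices
    (∃ C : ℝ, ∀ (n dIn dOut d L : ℕ) (P : Measure ℝ) (σ : ℝ)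
        (A : Matrix (Fin d) (Fin dIn) ℝ) (B : Matrix (Fin dOut) (Fin d) ℝ)
        (x : Fin n → Fin dIn → ℝ) (y : Fin n → Fin dOut → ℝ),
      IsInitLaw P σ → frobNorm B ≤ R →
      (∀ s, euclNorm (A *ᵥ x s) ≤ R) → (∀ s, euclNorm (y s) ≤ R) →
      (∀ k : Fin L,
        Integrable (fun W => gradNorm act A B x y W k) (initLaw P L d) ∧
        ∫ W, gradNorm act A B x y W k ∂(initLaw P L d) ≤
          C * √(act.widthFactor d) *
            (lam act d σ ^ (((L : ℝ) - 1) / 2) + lam act d σ ^ ((2 * (L : ℝ) - 1) / 2)) ∧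
        (0 < lam act d σ → lam act d σ ≤ 1 →
          ∫ W, gradNorm act A B x y W k ∂(initLaw P L d) ≤
            C * √(act.widthFactor d / lam act d σ) * lam act d σ ^ ((L : ℝ) / 2))) ∧
      (∀ k : Fin L,
        Integrable (fun W => hessNorm act A B x y W k k) (initLaw P L d) ∧
        ∫ W, hessNorm act A B x y W k k ∂(initLaw P L d) ≤
          C * act.widthFactor d * lam act d σ ^ ((L : ℝ) - 1) ∧
        (0 < lam act d σ →
          ∫ W, hessNorm act A B x y W k k ∂(initLaw P L d) ≤
            C * (act.widthFactor d / lam act d σ) * lam act d σ ^ (L : ℝ))) ∧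
      (∀ k ℓ : Fin L, k ≠ ℓ →
        Integrable (fun W => hessNorm act A B x y W k ℓ) (initLaw P L d) ∧
        ∫ W, hessNorm act A B x y W k ℓ ∂(initLaw P L d) ≤
          C * √(d * act.widthFactor d) *
            (lam act d σ ^ (((L : ℝ) - 2) / 2) + lam act d σ ^ ((L : ℝ) - 1)) ∧
        (0 < lam act d σ → lam act d σ ≤ 1 →
          ∫ W, hessNorm act A B x y W k ℓ ∂(initLaw P L d) ≤
            C * (√(d * act.widthFactor d) / lam act d σ) * lam act d σ ^ ((L : ℝ) / 2)))) ∧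
    -- input and output matrices with i.i.d. entries of the same law
    (∀ dOut : ℕ, ∃ C : ℝ, ∀ (n dIn d L : ℕ) (P : Measure ℝ) (σ : ℝ)
        (x : Fin n → Fin dIn → ℝ) (y : Fin n → Fin dOut → ℝ),
      IsInitLaw P σ → (∀ s, euclNorm (x s) ≤ R) → (∀ s, euclNorm (y s) ≤ R) →
      (∀ k : Fin L,
        Integrable (fun θ => gradNorm act (Matrix.of θ.1) (Matrix.of θ.2.1) x y θ.2.2 k)
          (jointLaw P dIn dOut d L) ∧
        ∫ θ, gradNorm act (Matrix.of θ.1) (Matrix.of θ.2.1) x y θ.2.2 k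
            ∂(jointLaw P dIn dOut d L) ≤
          C * (lam act d σ ^ (((L : ℝ) + 1) / 2) + lam act d σ ^ ((2 * (L : ℝ) + 3) / 2)) ∧
        (lam act d σ ≤ 1 →
          ∫ θ, gradNorm act (Matrix.of θ.1) (Matrix.of θ.2.1) x y θ.2.2 k
              ∂(jointLaw P dIn dOut d L) ≤
            C * lam act d σ ^ ((L : ℝ) / 2))) ∧
      (∀ k : Fin L,
        Integrable (fun θ => hessNorm act (Matrix.of θ.1) (Matrix.of θ.2.1) x y θ.2.2 k k)
          (jointLaw P dIn dOut d L) ∧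
        ∫ θ, hessNorm act (Matrix.of θ.1) (Matrix.of θ.2.1) x y θ.2.2 k k
            ∂(jointLaw P dIn dOut d L) ≤
          C * lam act d σ ^ ((L : ℝ) + 1) ∧
        (lam act d σ ≤ 1 →
          ∫ θ, hessNorm act (Matrix.of θ.1) (Matrix.of θ.2.1) x y θ.2.2 k k
              ∂(jointLaw P dIn dOut d L) ≤
            C * lam act d σ ^ (L : ℝ))) ∧
      (∀ k ℓ : Fin L, k ≠ ℓ →
        Integrable (fun θ => hessNorm act (Matrix.of θ.1) (Matrix.of θ.2.1) x y θ.2.2 k ℓ)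
          (jointLaw P dIn dOut d L) ∧
        ∫ θ, hessNorm act (Matrix.of θ.1) (Matrix.of θ.2.1) x y θ.2.2 k ℓ
            ∂(jointLaw P dIn dOut d L) ≤
          C * (√d * lam act d σ ^ ((L : ℝ) / 2) + lam act d σ ^ ((L : ℝ) + 1)) ∧
        (lam act d σ ≤ 1 →
          ∫ θ, hessNorm act (Matrix.of θ.1) (Matrix.of θ.2.1) x y θ.2.2 k ℓ
              ∂(jointLaw P dIn dOut d L) ≤
            C * √d * lam act d σ ^ ((L : ℝ) / 2)))) ∧
    -- the derivatives above are those of the loss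
    (∀ (n dIn dOut d L : ℕ) (P : Measure ℝ) (σ : ℝ)
        (A : Matrix (Fin d) (Fin dIn) ℝ) (B : Matrix (Fin dOut) (Fin d) ℝ)
        (x : Fin n → Fin dIn → ℝ) (y : Fin n → Fin dOut → ℝ),
      IsInitLaw P σ → (act = Activation.linear ∨ ∀ t : ℝ, P {t} = 0) →
      ∀ᵐ W ∂(initLaw P L d),
        ContDiffAt ℝ (⊤ : ℕ∞) (loss act A B x y) W ∧
        (∀ k, gradBlock (loss act A B x y) W k = gradBlock (gatedLoss act A B x y W) W k) ∧
        (∀ k ℓ, hessBlock (loss act A B x y) W k ℓ =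
          hessBlock (gatedLoss act A B x y W) W k ℓ)) := by
  refine ⟨⟨2 * (|R| ^ 3 + |R| ^ 4), ?_⟩, fun dOut => ⟨8 * (√dOut ^ 2 + √dOut) * |R| ^ 2, ?_⟩, ?_⟩
  · intro n dIn dOut d L P σ A B x y hP hB hx hy
    exact expected_norms_fixed_le hP act hB hx hy
  · intro n dIn d L P σ x y hP hx hy
    exact expected_norms_random_le hP act hx hy
  · intro n dIn dOut d L P σ A B x y hP hact
    exact ae_derivatives_loss_eq act hP hact A B x y
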